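/- Let $H\in[1/2,1)$ and $V>0$, and put $I=[-1/2,1/2]$. Let $h:I\to\mathbb R$ (the spectral density of a real short-memory process $Y$) be even, continuous and strictly positive on $I$, and three times continuously differentiable on $(-1/2,1/2)$. Let $$f_H(x)=h(x)\,|2\sin \pi x|^{-(2H-1)}$$ be the spectral density of the fractionally differenced process $(1-B)^{-(H-1/2)}Y$, where $B$ is the backshift operator, and let $$f_H^*(x)=c_f^*\,\pi^{-2}(2\pi)^{2H+1}\sin^2(\pi x)\sum_{j\in\mathbb Z}|2\pi j+2\pi x|^{-(2H+1)}$$ be that of fractional Gaussian noise with Hurst parameter $H$ and variance $V$, where $c_f^*=V(2\pi)^{2-2H}C(H)$ and $C(H)=\pi^{-1}H\,\Gamma(2H)\sin(\pi H)$. Put $c_f=(2\pi)^{1-2H}h(0)$. Define $g(x)=f_H(x)/f_H^*(x)$ for $x\neq0$ and $g(0)=\lim_{x\to0}g(x)$. For $\alpha\ge0$ let $\Lambda_\alpha$ be the set of $\varphi:I\to\mathbb R$ for which there is a constant $C$ with $|\varphi(x)-\varphi(y)|\le C|x-y|^\alpha$ for all $x,y\in I$, and let $BV$ be the set of functions of bounded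 variation on $I$. At the end points of $I$, derivatives are one-sided; "$C^3$ on $I$" means $C^3$ up to the end points. Then the limit defining $g(0)$ exists, $g(0)=c_f/c_f^*=h(0)/(2\pi V C(H))$, and the following hold. (i) On $I$, $g$ is even, continuous, positive, bounded, and in $L^p$ for every $p>0$. (ii) $g$ is twice differentiable on $(-1/2,1/2)$, and on all of $I$ if $h$ is $C^3$ on $I$. Away from $0$, $g$ is as smooth as $h$: the function $g/h$ is $C^\infty$ on $I\setminus\{0\}$, and for all $n\in\{0,1,2,\dots,\infty\}$ and $x\in I\setminus\{0\}$, if $h$ is $C^n$ at $x$, then $g$ is $C^n$ at $x$. (In particular $g$ is $C^3$ on $(-1/2,1/2)\setminus\{0\}$, and $C^\infty$ on $I\setminus\{0\}$ if $h$ is $C^\infty$ there.) (iii) If $h$ is $C^3$ on $I$, then $g''\in\Lambda_{2H-1}\cap BV$. If $H>1/2$, then $g''\notin\Lambda_{\beta'}$ for every $\beta'>2H-1$; indeed $g''$ satisfies no Hölder condition of exponent $\beta'$ on $(-1/2,1/2)$. (iv) Suppose that $h$ is $C^3$ on $I$ and $h'(1/2)=0$ (equivalently, given that $h$ is even and $C^3$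 on $I$, the $1$-periodic extension of $h$ is continuously differentiable; this is automatic if that extension is $C^3$ on $\mathbb R$). Let $G_j=\int_{-1/2}^{1/2}g(x)e^{-2\pi i jx}\,dx$, $j\in\mathbb Z$. Then $g(x)=\sum_{j\in\mathbb Z}G_je^{2\pi i jx}$ for all $x\in I$, the series converging absolutely, $\sum_{j\in\mathbb Z}j^2|G_j|<\infty$, and $G_n=O(|n|^{-3})$ as $|n|\to\infty$. In particular $\sum_j|G_j|<\infty$, and $\sum_j|j|^\alpha|G_j|<\infty$ for $1<\alpha<2$. -/

import Mathlib

open Set Filter Topology MeasureTheory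
open scoped NNReal ENNReal ContDiff

noncomputable section

namespace FracDiff

/-- The interval `[-1/2, 1/2]` of normalised frequencies. -/
abbrev freq : Set ℝ := Icc (-1 / 2) (1 / 2)

/-- The spectral density `f_H(x) = h(x) |2 sin πx|^{-(2H-1)}` of the fractionally differenced
process `(1 - B)^{-(H-1/2)} Y`, where `h` is the spectral density of `Y`. -/
def fracSpectralDensity (H : ℝ) (h : ℝ → ℝ) (x : ℝ) : ℝ :=
  h x * |2 * Real.sin (Real.pi * x)| ^ (-(2 * H - 1))

/-- The constant `C(H) = π⁻¹ H Γ(2H) sin(πH)`. -/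
def hurstConst (H : ℝ) : ℝ :=
  Real.pi⁻¹ * H * Real.Gamma (2 * H) * Real.sin (H * Real.pi)

/-- The prefactor `c_f = (2π)^{1-2H} h(0)` of the power law of `f_H` at the origin. -/
def fracPrefactor (H : ℝ) (h : ℝ → ℝ) : ℝ :=
  (2 * Real.pi) ^ (1 - 2 * H) * h 0

/-- The prefactor `c_f^* = V (2π)^{2-2H} C(H)` of the power law of `f_H^*` at the origin. -/
def fgnPrefactor (H V : ℝ) : ℝ :=
  V * (2 * Real.pi) ^ (2 - 2 * H) * hurstConst H

/-- The spectral density `f_H^*` of fractional Gaussian noise with Hurst parameter `H` and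
variance `V`, in normalised frequency. -/
def fgnSpectralDensity (H V : ℝ) (x : ℝ) : ℝ :=
  fgnPrefactor H V * (Real.pi ^ 2)⁻¹ * (2 * Real.pi) ^ (2 * H + 1) *
    Real.sin (Real.pi * x) ^ 2 *
      ∑' j : ℤ, |2 * Real.pi * (j : ℝ) + 2 * Real.pi * x| ^ (-(2 * H + 1))

/-- The quotient `f_H / f_H^*`; only its values at `x ≠ 0` are meaningful. -/
def rawRatio (H V : ℝ) (h : ℝ → ℝ) (x : ℝ) : ℝ :=
  fracSpectralDensity H h x / fgnSpectralDensity H V x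

/-- The spectral ratio `g`: `g(x) = f_H(x) / f_H^*(x)` for `x ≠ 0`, and `g(0)` is the limit of
this quotient as `x → 0`, `x ≠ 0`. -/
def spectralRatio (H V : ℝ) (h : ℝ → ℝ) : ℝ → ℝ :=
  Function.update (rawRatio H V h) 0 (limUnder (𝓝[≠] (0 : ℝ)) (rawRatio H V h))

/-- The first derivative over `[-1/2, 1/2]` (one-sided at the two end points). -/
def deriv₁ (φ : ℝ → ℝ) : ℝ → ℝ := derivWithin φ freq

/-- The second derivative over `[-1/2, 1/2]` (one-sided at the two end points). -/
def deriv₂ (φ : ℝ → ℝ) : ℝ → ℝ := derivWithin (derivWithin φ freq) freq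

/-- Membership in `Λ_α`: the function is uniformly `α`-Hölder continuous on `[-1/2, 1/2]`. -/
def MemLambda (α : ℝ≥0) (φ : ℝ → ℝ) : Prop :=
  ∃ C : ℝ≥0, HolderOnWith C α φ freq

/-- The Fourier coefficient `∫_{-1/2}^{1/2} φ(x) e^{-2πijx} dx`. -/
def fourierCoefficient (φ : ℝ → ℝ) (j : ℤ) : ℂ :=
  fourierCoeffOn (show (-1 / 2 : ℝ) < 1 / 2 by norm_num) (fun x => (φ x : ℂ)) j

end FracDiff

end

noncomputable section

namespace FracDiff

/-! Put a = 2H - 1. Isolate the term j = 0 of the series and write sin πx = πx sinc(πx): all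
negative powers of |x| cancel, leaving g = h · S / (1 + |x|^(a+2) w) (`rawRatio_eq`). Here S is a
constant over sinc(πx)^(2H+1) and w is the sum over j ≠ 0; both are smooth and positive on (-1,1).
Hence g is even, continuous and positive, and its only roughness, apart from that of h, comes from
|x|^(a+2).

Two differentiations give g'' = b |x|^a + r with r of class C¹ and b = -(a+2)(a+1) h(0) S(0) w(0) ≠
0 (`exists_second_deriv_expansion`, `exists_deriv₂_expansion`). The Hölder exponent, its optimality
and bounded variation are read off from this form.

For the Fourier series, S/(1 + |x|^(a+2) w) is invariant under x ↦ 1 - x on (0,1), so its derivative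
vanishes at 1/2; with h'(1/2) = 0 this gives g'(±1/2) = 0. Two integrations by parts then have no
boundary terms, and G_n is at most n⁻² times the coefficient of g''. The latter is summable and
O(1/n): for |x|^a with a > 0 by the bound n^(-1-a), for r because r' has square-summable
coefficients. -/

/-! ### Smoothness of sinc and of the shifted zeta series. -/

theorem contDiff_sinc : ContDiff ℝ ∞ Real.sinc := by
  -- Removable singularity: the slope of the complex sine at 0 is entire, and sinc is its real part
  -- on the real line.
  have hd : Differentiable ℂ (dslope Complex.sin 0) := by
    have := (Complex.differentiableOn_dslope (f := Complex.sin) (s := univ) (c := 0)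
      univ_mem).2 Complex.differentiable_sin.differentiableOn
    exact differentiableOn_univ.1 this
  have h := ContDiff.real_of_complex (hd.contDiff (n := ∞))
  have e : Real.sinc = fun x : ℝ => (dslope Complex.sin 0 (x : ℂ)).re := by
    funext x
    by_cases hx : x = 0
    · subst hx
      simp [dslope_same]
    · rw [dslope_of_ne _ (by exact_mod_cast hx), Real.sinc_of_ne_zero hx, slope_def_field]
      simp only [Complex.sin_zero, sub_zero]
      rw [← Complex.ofReal_sin, ← Complex.ofReal_div, Complex.ofReal_re]
  rw [e]
  exact h

theorem sinc_pos {x : ℝ} (hx : |x| < Real.pi) : 0 < Real.sinc x := by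
  have key : ∀ y : ℝ, 0 < y → y < Real.pi → 0 < Real.sinc y := fun y h0 h1 => by
    rw [Real.sinc_of_ne_zero h0.ne']
    exact div_pos (Real.sin_pos_of_pos_of_lt_pi h0 h1) h0
  rcases lt_trichotomy x 0 with h | h | h
  · rw [← Real.sinc_neg]
    exact key _ (by linarith) (by rwa [abs_of_neg h] at hx)
  · simp [h]
  · exact key _ h (by rwa [abs_of_pos h] at hx)

/-- The Hurwitz type series `∑ (n + y)^{-s}`. -/
def shiftedZeta (s y : ℝ) : ℝ := ∑' n : ℕ, ((n : ℝ) + y) ^ (-s)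

theorem summable_shiftedZeta {s y : ℝ} (hs : 1 < s) (hy : 0 < y) :
    Summable fun n : ℕ => ((n : ℝ) + y) ^ (-s) := by
  have h := Real.summable_one_div_nat_add_rpow y s |>.2 hs
  refine h.congr fun n => ?_
  rw [abs_of_pos (by positivity), Real.rpow_neg (by positivity), one_div]

theorem shiftedZeta_pos {s y : ℝ} (hs : 1 < s) (hy : 0 < y) : 0 < shiftedZeta s y :=
  (summable_shiftedZeta hs hy).tsum_pos (fun n => by positivity) 0 (by positivity)

/-- Passing to complex arguments replaces termwise differentiation by the Weierstrass theorem: a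
dominated series of holomorphic functions is holomorphic. -/
theorem contDiffOn_shiftedZeta {s : ℝ} (hs : 1 < s) :
    ContDiffOn ℝ ∞ (shiftedZeta s) (Ioi 0) := by
  intro y hy
  have hy : 0 < y := hy
  -- On this half-plane |n + z| ≥ n + y/2, so the series at y/2 is a summable majorant.
  set U : Set ℂ := {z | y / 2 < z.re} with hU
  have hUo : IsOpen U := isOpen_lt continuous_const Complex.continuous_re
  have hpos : ∀ (n : ℕ) (z : ℂ), z ∈ U → 0 < ((n : ℂ) + z).re := fun n z hz => by
    have hz : y / 2 < z.re := hz
    have : (0 : ℝ) ≤ n := n.cast_nonneg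
    simp only [Complex.add_re, Complex.natCast_re]
    linarith
  have hd : DifferentiableOn ℂ (fun z : ℂ => ∑' n : ℕ, ((n : ℂ) + z) ^ (-(s : ℂ))) U := by
    refine Complex.differentiableOn_tsum_of_summable_norm
      (summable_shiftedZeta hs (half_pos hy)) (fun n z hz => ?_) hUo (fun n z hz => ?_)
    · have : DifferentiableAt ℂ (fun z : ℂ => (n : ℂ) + z) z := by fun_prop
      exact (this.cpow (differentiableAt_const _) (Or.inl (hpos n z hz))).differentiableWithinAt
    · rw [← Complex.ofReal_neg, Complex.norm_cpow_real]
      have h1 : (n : ℝ) + y / 2 ≤ ‖(n : ℂ) + z‖ := by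
        refine le_trans ?_ (Complex.re_le_norm _)
        have hz : y / 2 < z.re := hz
        simp only [Complex.add_re, Complex.natCast_re]
        linarith
      exact Real.rpow_le_rpow_of_nonpos (by positivity) h1 (by linarith)
  have hyU : (y : ℂ) ∈ U := by
    change y / 2 < (y : ℂ).re
    rw [Complex.ofReal_re]
    linarith
  have hc : ContDiffAt ℝ ∞ (fun t : ℝ => (∑' n : ℕ, ((n : ℂ) + t) ^ (-(s : ℂ))).re) y :=
    ContDiffAt.real_of_complex (e := fun z : ℂ => ∑' n : ℕ, ((n : ℂ) + z) ^ (-(s : ℂ)))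
      ((hd.contDiffOn hUo).contDiffAt (hUo.mem_nhds hyU))
  refine (hc.congr_of_eventuallyEq ?_).contDiffWithinAt
  filter_upwards [Ioi_mem_nhds hy] with t ht
  have ht : 0 < t := ht
  have : ∀ n : ℕ, ((n : ℂ) + t) ^ (-(s : ℂ)) = (((n : ℝ) + t) ^ (-s) : ℝ) := fun n => by
    rw [Complex.ofReal_cpow (by positivity)]
    push_cast
    rfl
  simp_rw [this]
  rw [← Complex.ofReal_tsum, Complex.ofReal_re]
  rfl

/-- The series `∑_{j ≠ 0} |j + x|^{-s}`, for `|x| < 1`. -/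
def puncturedSeries (s x : ℝ) : ℝ := shiftedZeta s (1 + x) + shiftedZeta s (1 - x)

theorem puncturedSeries_neg (s x : ℝ) : puncturedSeries s (-x) = puncturedSeries s x := by
  simp only [puncturedSeries, sub_neg_eq_add, ← sub_eq_add_neg]
  ring

theorem puncturedSeries_pos {s x : ℝ} (hs : 1 < s) (hx : x ∈ Ioo (-1 : ℝ) 1) :
    0 < puncturedSeries s x :=
  add_pos (shiftedZeta_pos hs (by linarith [hx.1])) (shiftedZeta_pos hs (by linarith [hx.2]))

theorem contDiffOn_puncturedSeries {s : ℝ} (hs : 1 < s) :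
    ContDiffOn ℝ ∞ (puncturedSeries s) (Ioo (-1) 1) := by
  refine ContDiffOn.add ?_ ?_
  · exact (contDiffOn_shiftedZeta hs).comp (by fun_prop) fun x hx => by
      simp only [mem_Ioi]; linarith [hx.1]
  · exact (contDiffOn_shiftedZeta hs).comp (by fun_prop) fun x hx => by
      simp only [mem_Ioi]; linarith [hx.2]

theorem hasSum_int_abs_rpow {s x : ℝ} (hs : 1 < s) (hx : x ∈ Ioo (-1 : ℝ) 1) :
    HasSum (fun j : ℤ => |(j : ℝ) + x| ^ (-s)) (|x| ^ (-s) + puncturedSeries s x) := by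
  have h1 : HasSum _ (shiftedZeta s (1 + x)) :=
    (summable_shiftedZeta hs (by linarith [hx.1])).hasSum
  have h2 : HasSum _ (shiftedZeta s (1 - x)) :=
    (summable_shiftedZeta hs (by linarith [hx.2])).hasSum
  have key := HasSum.of_add_one_of_neg_add_one (f := fun j : ℤ => |(j : ℝ) + x| ^ (-s))
    (m := shiftedZeta s (1 + x)) (m' := shiftedZeta s (1 - x)) ?_ ?_
  · convert key using 1
    simp only [Int.cast_zero, zero_add, puncturedSeries]
    ring
  · convert h1 using 2 with n
    have : (0 : ℝ) ≤ n := n.cast_nonneg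
    push_cast
    rw [abs_of_pos (by linarith [hx.1]), add_assoc]
  · convert h2 using 2 with n
    have : (0 : ℝ) ≤ n := n.cast_nonneg
    push_cast
    rw [abs_of_neg (by linarith [hx.2])]
    congr 1
    ring

/-- Reindex by j ↦ -1 - j. This is the source of the symmetry about 1/2. -/
theorem tsum_int_abs_rpow_one_sub (s x : ℝ) :
    ∑' j : ℤ, |(j : ℝ) + (1 - x)| ^ (-s) = ∑' j : ℤ, |(j : ℝ) + x| ^ (-s) := by
  rw [← (Equiv.subLeft (-1 : ℤ)).tsum_eq]
  refine tsum_congr fun j => ?_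
  rw [Equiv.subLeft_apply, ← abs_neg]
  push_cast
  congr 2
  ring

/-! ### Calculus of |x|^a at the origin. -/

theorem continuous_abs_rpow {a : ℝ} (ha : 0 ≤ a) : Continuous fun x : ℝ => |x| ^ a :=
  continuous_abs.rpow_const fun _ => Or.inr ha

/-- Covers a = 0 (that is, H = 1/2) uniformly: there |0|^a = 1, but the factor a vanishes. -/
theorem mul_abs_zero_rpow {a : ℝ} : a * |(0 : ℝ)| ^ a = 0 := by
  rcases eq_or_ne a 0 with rfl | h
  · simp
  · simp [Real.zero_rpow h]

theorem hasDerivAt_abs_rpow_of_ne_zero (a : ℝ) {x : ℝ} (hx : x ≠ 0) :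
    HasDerivAt (fun y : ℝ => |y| ^ a) (a * |x| ^ a / x) x := by
  have h := (hasDerivAt_abs hx).rpow_const (p := a) (Or.inl (abs_ne_zero.2 hx))
  convert h using 1
  rw [Real.rpow_sub_one (abs_ne_zero.2 hx)]
  rcases hx.lt_or_gt with h | h
  · rw [abs_of_neg h]
    simp [h]
    field_simp
  · rw [abs_of_pos h]
    simp [h]
    field_simp

/-- At the origin the difference quotient is |y|^a itself, which is continuous. -/
theorem hasDerivAt_mul_abs_rpow {a : ℝ} (ha : 0 ≤ a) (x : ℝ) :
    HasDerivAt (fun y : ℝ => y * |y| ^ a) ((1 + a) * |x| ^ a) x := by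
  rcases eq_or_ne x 0 with rfl | hx
  · rw [hasDerivAt_iff_tendsto_slope, add_mul, mul_abs_zero_rpow, one_mul, add_zero]
    refine Tendsto.congr' ?_ ((continuous_abs_rpow ha).tendsto 0 |>.mono_left nhdsWithin_le_nhds)
    filter_upwards [self_mem_nhdsWithin] with y hy
    have hy : y ≠ 0 := hy
    rw [slope_def_field]
    simp [hy]
  · refine ((hasDerivAt_id x).mul (hasDerivAt_abs_rpow_of_ne_zero a hx)).congr_deriv ?_
    simp only [id]
    field_simp

theorem contDiff_mul_abs_rpow {a : ℝ} (ha : 0 ≤ a) :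
    ContDiff ℝ 1 fun y : ℝ => y * |y| ^ a := by
  rw [contDiff_one_iff_deriv]
  refine ⟨fun x => (hasDerivAt_mul_abs_rpow ha x).differentiableAt, ?_⟩
  rw [funext fun x => (hasDerivAt_mul_abs_rpow ha x).deriv]
  exact continuous_const.mul (continuous_abs_rpow ha)

/-- The zero of b - b(0) compensates the singular derivative of |x|^a: the term a |x|^a (b(x) -
b(0))/x is |x|^a times a slope, and `dslope` extends that slope continuously to 0. -/
theorem contDiffOn_abs_rpow_mul_sub {a : ℝ} (ha : 0 ≤ a) {T : Set ℝ} (hT : UniqueDiffOn ℝ T)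
    (h0 : T ∈ 𝓝 (0 : ℝ)) {b : ℝ → ℝ} (hb : ContDiffOn ℝ 1 b T) :
    ContDiffOn ℝ 1 (fun x => |x| ^ a * (b x - b 0)) T := by
  have hbd := hb.differentiableOn one_ne_zero
  have hd : ∀ x ∈ T, HasDerivWithinAt (fun x => |x| ^ a * (b x - b 0))
      (a * |x| ^ a * dslope b 0 x + |x| ^ a * derivWithin b T x) T x := by
    intro x hx
    rcases eq_or_ne x 0 with rfl | hx0
    · refine HasDerivAt.hasDerivWithinAt ?_
      have hb0 : HasDerivAt b (derivWithin b T 0) 0 :=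
        (hbd 0 hx).hasDerivWithinAt.hasDerivAt h0
      rw [hasDerivAt_iff_tendsto_slope, mul_abs_zero_rpow, zero_mul, zero_add]
      refine Tendsto.congr' ?_ (((continuous_abs_rpow ha).tendsto 0 |>.mono_left
        nhdsWithin_le_nhds).mul (hasDerivAt_iff_tendsto_slope.1 hb0))
      filter_upwards with y
      simp only [slope_def_field, sub_self, mul_zero, sub_zero]
      ring
    · refine ((hasDerivAt_abs_rpow_of_ne_zero a hx0).hasDerivWithinAt.mul
        ((hbd x hx).hasDerivWithinAt.sub_const (b 0))).congr_deriv ?_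
      rw [dslope_of_ne _ hx0, slope_def_field]
      simp only [sub_zero]
      field_simp
  rw [show (1 : WithTop ℕ∞) = 0 + 1 by simp, contDiffOn_succ_iff_derivWithin hT]
  refine ⟨fun x hx => (hd x hx).differentiableWithinAt, by simp, contDiffOn_zero.2 ?_⟩
  refine ContinuousOn.congr ?_ fun x hx => (hd x hx).derivWithin (hT x hx)
  have hc := (continuous_abs_rpow ha).continuousOn (s := T)
  refine ((continuousOn_const.mul hc).mul ?_).add
    (hc.mul (hb.continuousOn_derivWithin hT le_rfl))
  exact (continuousOn_dslope h0).2
    ⟨hb.continuousOn, (hbd 0 (mem_of_mem_nhds h0)).differentiableAt h0⟩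

/-- The second derivative of `k / (1 + |x|^{a+2} w)` is `|x|^a` times a constant, up to a
`C¹` function. -/
theorem exists_second_deriv_expansion {a : ℝ} (ha : 0 ≤ a) {T : Set ℝ} (hT : UniqueDiffOn ℝ T)
    (h0 : T ∈ 𝓝 (0 : ℝ)) {k w : ℝ → ℝ} (hk : ContDiffOn ℝ 3 k T) (hw : ContDiffOn ℝ 3 w T)
    (hD : ∀ x ∈ T, 1 + |x| ^ (a + 2) * w x ≠ 0) :
    ∃ g₁ g₂ r : ℝ → ℝ,
      (∀ x ∈ T, HasDerivWithinAt (fun x => k x / (1 + |x| ^ (a + 2) * w x)) (g₁ x) T x) ∧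
      (∀ x ∈ T, HasDerivWithinAt g₁ (g₂ x) T x) ∧ ContDiffOn ℝ 1 r T ∧
      ∀ x ∈ T, g₂ x = -((a + 2) * (a + 1) * k 0 * w 0) * |x| ^ a + r x := by
  -- The factorization |x|^(a+2) = x p(x) with p of class C¹ confines the non-C¹ part to p' =
  -- (1+a)|x|^a.
  set p : ℝ → ℝ := fun y => y * |y| ^ a with hp
  have hp1 : ContDiffOn ℝ 1 p T := (contDiff_mul_abs_rpow ha).contDiffOn
  have hpd : ∀ x, HasDerivWithinAt p ((1 + a) * |x| ^ a) T x := fun x =>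
    (hasDerivAt_mul_abs_rpow ha x).hasDerivWithinAt
  have hxp : ∀ x : ℝ, |x| ^ (a + 2) = x * p x := fun x => by
    rcases eq_or_ne x 0 with rfl | hx
    · simp [Real.zero_rpow (by linarith : a + 2 ≠ 0)]
    · rw [Real.rpow_add (abs_pos.2 hx), Real.rpow_two, sq_abs]
      simp only [hp]
      ring
  simp only [hxp] at hD ⊢
  set k₁ := derivWithin k T
  set k₂ := derivWithin k₁ T
  set w₁ := derivWithin w T
  set w₂ := derivWithin w₁ T
  have hk1 : ContDiffOn ℝ 2 k₁ T := hk.derivWithin hT (by norm_num)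
  have hk2 : ContDiffOn ℝ 1 k₂ T := hk1.derivWithin hT (by norm_num)
  have hw1 : ContDiffOn ℝ 2 w₁ T := hw.derivWithin hT (by norm_num)
  have hw2 : ContDiffOn ℝ 1 w₂ T := hw1.derivWithin hT (by norm_num)
  have dk : ∀ x ∈ T, HasDerivWithinAt k (k₁ x) T x := fun x hx =>
    (hk.differentiableOn (by norm_num) x hx).hasDerivWithinAt
  have dk1 : ∀ x ∈ T, HasDerivWithinAt k₁ (k₂ x) T x := fun x hx =>
    (hk1.differentiableOn (by norm_num) x hx).hasDerivWithinAt
  have dw : ∀ x ∈ T, HasDerivWithinAt w (w₁ x) T x := fun x hx =>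
    (hw.differentiableOn (by norm_num) x hx).hasDerivWithinAt
  have dw1 : ∀ x ∈ T, HasDerivWithinAt w₁ (w₂ x) T x := fun x hx =>
    (hw1.differentiableOn (by norm_num) x hx).hasDerivWithinAt
  -- D₁ is the derivative of the denominator D, and E is the C¹ part of the derivative of D₁.
  set D : ℝ → ℝ := fun x => 1 + x * p x * w x with hDdef
  set D₁ : ℝ → ℝ := fun x => (a + 2) * p x * w x + x * p x * w₁ x with hD₁def
  set E : ℝ → ℝ := fun x => 2 * (a + 2) * p x * w₁ x + x * p x * w₂ x with hEdef
  have hDne : ∀ x ∈ T, D x ≠ 0 := hD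
  have dxp : ∀ x, HasDerivWithinAt (fun y => y * p y) ((a + 2) * p x) T x := fun x => by
    refine ((hasDerivWithinAt_id x T).mul (hpd x)).congr_deriv ?_
    simp only [id, hp]
    ring
  have dD : ∀ x ∈ T, HasDerivWithinAt D (D₁ x) T x := fun x hx =>
    ((dxp x).mul (dw x hx)).const_add 1
  have dD₁ : ∀ x ∈ T,
      HasDerivWithinAt D₁ ((a + 2) * (a + 1) * |x| ^ a * w x + E x) T x := fun x hx => by
    refine ((((hpd x).const_mul (a + 2)).mul (dw x hx)).add
      ((dxp x).mul (dw1 x hx))).congr_deriv ?_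
    simp only [hEdef]
    ring
  have c1 : ∀ {φ : ℝ → ℝ}, ContDiffOn ℝ 2 φ T → ContDiffOn ℝ 1 φ T := fun h =>
    h.of_le (by norm_num)
  have c2 : ∀ {φ : ℝ → ℝ}, ContDiffOn ℝ 3 φ T → ContDiffOn ℝ 1 φ T := fun h =>
    h.of_le (by norm_num)
  have hx1 : ContDiffOn ℝ 1 (fun x : ℝ => x) T := contDiffOn_id
  have cD : ContDiffOn ℝ 1 D T := contDiffOn_const.add ((hx1.mul hp1).mul (c2 hw))
  have cD₁ : ContDiffOn ℝ 1 D₁ T :=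
    ((contDiffOn_const.mul hp1).mul (c2 hw)).add ((hx1.mul hp1).mul (c1 hw1))
  have cE : ContDiffOn ℝ 1 E T :=
    ((contDiffOn_const.mul hp1).mul (c1 hw1)).add ((hx1.mul hp1).mul hw2)
  -- The full coefficient of |x|^a in the second derivative; freezing it at 0 costs |x|^a (b(x) -
  -- b(0)), which is C¹ and joins the remainder.
  set b : ℝ → ℝ := fun x => -((a + 2) * (a + 1)) * (k x * w x) / D x ^ 2 with hbdef
  have hD2 : ∀ x ∈ T, D x ^ 2 ≠ 0 := fun x hx => pow_ne_zero _ (hDne x hx)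
  have hD3 : ∀ x ∈ T, D x ^ 3 ≠ 0 := fun x hx => pow_ne_zero _ (hDne x hx)
  have cb : ContDiffOn ℝ 1 b T :=
    (contDiffOn_const.mul ((c2 hk).mul (c2 hw))).div (cD.pow 2) hD2
  have hb0 : b 0 = -((a + 2) * (a + 1) * k 0 * w 0) := by
    simp only [hbdef, hDdef]
    simp
    ring
  refine ⟨fun x => k₁ x / D x - k x * D₁ x / D x ^ 2,
    fun x => -((a + 2) * (a + 1) * k 0 * w 0) * |x| ^ a +
      (k₂ x / D x - 2 * (k₁ x * D₁ x) / D x ^ 2 + 2 * (k x * D₁ x ^ 2) / D x ^ 3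
        - k x * E x / D x ^ 2 + |x| ^ a * (b x - b 0)), _, ?_, ?_, ?_, fun x _ => rfl⟩
  · intro x hx
    refine ((dk x hx).div (dD x hx) (hDne x hx)).congr_deriv ?_
    have := hDne x hx
    field_simp
  · intro x hx
    refine (((dk1 x hx).div (dD x hx) (hDne x hx)).sub
      (((dk x hx).mul (dD₁ x hx)).div ((dD x hx).pow 2) (hD2 x hx))).congr_deriv ?_
    have := hDne x hx
    rw [hb0]
    simp only [hbdef, Pi.pow_apply, Pi.mul_apply]
    field_simp
    ring
  · exact ((((hk2.div cD hDne).sub ((contDiffOn_const.mul ((c1 hk1).mul cD₁)).div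
      (cD.pow 2) hD2)).add ((contDiffOn_const.mul ((c2 hk).mul (cD₁.pow 2))).div
      (cD.pow 3) hD3)).sub (((c2 hk).mul cE).div (cD.pow 2) hD2)).add
      (contDiffOn_abs_rpow_mul_sub ha hT h0 cb)

/-! ### Hölder continuity and bounded variation of b |x|^a + r. -/

/-- Subadditivity of t ↦ t^a for 0 ≤ a ≤ 1. -/
theorem abs_sub_abs_rpow_le {a : ℝ} (ha : 0 ≤ a) (ha1 : a ≤ 1) (x y : ℝ) :
    |(|x| ^ a - |y| ^ a)| ≤ |x - y| ^ a := by
  have key : ∀ x y : ℝ, |x| ^ a - |y| ^ a ≤ |x - y| ^ a := fun x y => by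
    have h1 : |x| ≤ |x - y| + |y| := by
      simpa using abs_add_le (x - y) y
    have h2 := (Real.rpow_le_rpow (abs_nonneg x) h1 ha).trans
      (Real.rpow_add_le_add_rpow (abs_nonneg _) (abs_nonneg _) ha ha1)
    linarith
  refine abs_le.2 ⟨?_, key x y⟩
  have := key y x
  rw [abs_sub_comm] at this
  linarith

theorem holderOnWith_of_abs_le {C : ℝ≥0} {β : ℝ≥0} {f : ℝ → ℝ} {s : Set ℝ}
    (h : ∀ x ∈ s, ∀ y ∈ s, |f x - f y| ≤ C * |x - y| ^ (β : ℝ)) : HolderOnWith C β f s := by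
  intro x hx y hy
  rw [edist_dist, edist_dist, ENNReal.ofReal_rpow_of_nonneg dist_nonneg β.coe_nonneg,
    ← ENNReal.ofReal_coe_nnreal, ← ENNReal.ofReal_mul C.coe_nonneg]
  exact ENNReal.ofReal_le_ofReal (by simpa [Real.dist_eq] using h x hx y hy)

theorem holderOnWith_const_mul_abs_rpow_add {a : ℝ} (ha : 0 ≤ a) (ha1 : a ≤ 1) {s : Set ℝ}
    (hs : ∀ x ∈ s, ∀ y ∈ s, |x - y| ≤ 1) {f r : ℝ → ℝ} {b : ℝ} {L : ℝ≥0}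
    (hr : LipschitzOnWith L r s) (hf : ∀ x ∈ s, f x = b * |x| ^ a + r x) :
    ∃ C : ℝ≥0, HolderOnWith C a.toNNReal f s := by
  refine ⟨‖b‖₊ + L, holderOnWith_of_abs_le fun x hx y hy => ?_⟩
  rw [Real.coe_toNNReal a ha, hf x hx, hf y hy]
  have h1 := abs_sub_abs_rpow_le ha ha1 x y
  have h2 : |r x - r y| ≤ L * |x - y| := by simpa [Real.dist_eq] using hr.dist_le_mul x hx y hy
  have h3 : |x - y| ≤ |x - y| ^ a := by
    simpa using Real.rpow_le_rpow_of_exponent_ge' (abs_nonneg _) (hs x hx y hy) ha ha1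
  calc |b * |x| ^ a + r x - (b * |y| ^ a + r y)|
      = |b * (|x| ^ a - |y| ^ a) + (r x - r y)| := by congr 1; ring
    _ ≤ |b| * |(|x| ^ a - |y| ^ a)| + |r x - r y| := by
        rw [← abs_mul]; exact abs_add_le _ _
    _ ≤ |b| * |x - y| ^ a + L * |x - y| ^ a := by
        have := mul_le_mul_of_nonneg_left h3 L.coe_nonneg
        gcongr
        exact h2.trans this
    _ = _ := by push_cast; rw [Real.norm_eq_abs]; ring

/-- Comparing x > 0 with 0, a Hölder bound would give |b| x^a ≤ C x^β + O(x); divide by x^a and let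
x → 0. -/
theorem not_holderOnWith_const_mul_abs_rpow_add {a : ℝ} (ha0 : 0 < a) (ha1 : a < 1) {s : Set ℝ}
    (hs : s ∈ 𝓝 (0 : ℝ)) {f r : ℝ → ℝ} {b : ℝ} (hb : b ≠ 0)
    (hr : DifferentiableAt ℝ r 0) (hf : ∀ x ∈ s, f x = b * |x| ^ a + r x)
    {C β : ℝ≥0} (hβ : a < β) : ¬ HolderOnWith C β f s := by
  intro h
  have hbound : ∀ x ∈ s, 0 < x → |b| ≤ C * x ^ ((β : ℝ) - a) + |slope r 0 x| * x ^ (1 - a) := by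
    intro x hx hx0
    have hd := h.dist_le hx (mem_of_mem_nhds hs)
    rw [Real.dist_eq, Real.dist_eq, sub_zero, hf x hx, hf 0 (mem_of_mem_nhds hs), abs_zero,
      Real.zero_rpow ha0.ne', mul_zero, zero_add, abs_of_pos hx0] at hd
    have e : b * x ^ a = (b * x ^ a + r x - r 0) - slope r 0 x * x := by
      rw [slope_def_field, sub_zero, div_mul_cancel₀ _ hx0.ne']
      ring
    have h1 : |b| * x ^ a ≤ C * x ^ (β : ℝ) + |slope r 0 x| * x := by
      have := abs_sub (b * x ^ a + r x - r 0) (slope r 0 x * x)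
      rw [← e, abs_mul, abs_mul, abs_of_pos hx0, abs_of_pos (Real.rpow_pos_of_pos hx0 a)] at this
      linarith
    have hpos := Real.rpow_pos_of_pos hx0 a
    rw [Real.rpow_sub hx0, Real.rpow_sub hx0, Real.rpow_one]
    calc |b| = |b| * x ^ a / x ^ a := by field_simp
      _ ≤ (C * x ^ (β : ℝ) + |slope r 0 x| * x) / x ^ a := by gcongr
      _ = _ := by ring
  have ht : ∀ c : ℝ, 0 < c → Tendsto (fun x : ℝ => x ^ c) (𝓝[>] 0) (𝓝 0) := fun c hc => by
    have := (Real.continuousAt_rpow_const 0 c (Or.inr hc.le)).tendsto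
    rw [Real.zero_rpow hc.ne'] at this
    exact this.mono_left nhdsWithin_le_nhds
  have hsl : Tendsto (slope r 0) (𝓝[>] 0) (𝓝 (deriv r 0)) :=
    (hasDerivAt_iff_tendsto_slope.1 hr.hasDerivAt).mono_left
      (nhdsWithin_mono _ fun x hx => ne_of_gt hx)
  have hlim := ((ht _ (sub_pos.2 hβ)).const_mul (C : ℝ)).add (hsl.abs.mul (ht _ (sub_pos.2 ha1)))
  simp only [mul_zero, add_zero] at hlim
  have : |b| ≤ 0 := by
    refine ge_of_tendsto hlim ?_
    filter_upwards [self_mem_nhdsWithin, nhdsWithin_le_nhds hs] with x hx hxs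
    exact hbound x hxs hx
  exact hb (abs_nonpos_iff.1 this)

theorem boundedVariationOn_of_edist_le {f M : ℝ → ℝ} {s : Set ℝ} {C : ℝ≥0}
    (h : ∀ x ∈ s, ∀ y ∈ s, edist (f x) (f y) ≤ C * edist (M x) (M y))
    (hM : BoundedVariationOn M s) : BoundedVariationOn f s := by
  refine ne_top_of_le_ne_top (ENNReal.mul_ne_top ENNReal.coe_ne_top hM) (b := C * eVariationOn M s)
    (iSup_le ?_)
  rintro ⟨n, ⟨u, hu, us⟩⟩
  calc ∑ i ∈ Finset.range n, edist (f (u (i + 1))) (f (u i))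
      ≤ ∑ i ∈ Finset.range n, C * edist (M (u (i + 1))) (M (u i)) :=
        Finset.sum_le_sum fun i _ => h _ (us _) _ (us _)
    _ = C * ∑ i ∈ Finset.range n, edist (M (u (i + 1))) (M (u i)) := by rw [Finset.mul_sum]
    _ ≤ C * eVariationOn M s := by grw [eVariationOn.sum_le hu us]

/-- A Lipschitz function of a monotone function plus a Lipschitz function has bounded variation. -/
theorem boundedVariationOn_const_mul_monotone_add {u v c d b : ℝ} {f r m : ℝ → ℝ} {L : ℝ≥0}
    (hm : MonotoneOn m (Icc u v)) (hmb : ∀ x ∈ Icc u v, |m x| ≤ c)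
    (hr : LipschitzOnWith L r (Icc u v)) (hd : ∀ x ∈ Icc u v, |x| ≤ d)
    (hf : ∀ x ∈ Icc u v, f x = b * m x + r x) : BoundedVariationOn f (Icc u v) := by
  -- Increments of m + id dominate those of m and of id, hence up to a constant those of f.
  have hmon : MonotoneOn (fun x => m x + x) (Icc u v) := hm.add monotoneOn_id
  refine boundedVariationOn_of_edist_le (M := fun x => m x + x) (C := ‖b‖₊ + L) ?_
    (hmon.boundedVariationOn (C := c + d) fun x hx =>
      (abs_add_le _ _).trans (add_le_add (hmb x hx) (hd x hx)))
  have key : ∀ x ∈ Icc u v, ∀ y ∈ Icc u v, y ≤ x →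
      |f x - f y| ≤ (|b| + L) * |m x + x - (m y + y)| := by
    intro x hx y hy hxy
    have h1 := hm hy hx hxy
    have h2 : |r x - r y| ≤ L * |x - y| := by simpa [Real.dist_eq] using hr.dist_le_mul x hx y hy
    rw [abs_of_nonneg (sub_nonneg.2 hxy)] at h2
    rw [abs_of_nonneg (a := m x + x - (m y + y)) (by linarith), hf x hx, hf y hy]
    have h3 : |b * (m x - m y)| = |b| * (m x - m y) := by
      rw [abs_mul, abs_of_nonneg (sub_nonneg.2 h1)]
    have h4 := mul_nonneg (abs_nonneg b) (sub_nonneg.2 hxy)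
    have h5 := mul_nonneg L.coe_nonneg (sub_nonneg.2 h1)
    calc |b * m x + r x - (b * m y + r y)| = |b * (m x - m y) + (r x - r y)| := by congr 1; ring
      _ ≤ |b * (m x - m y)| + |r x - r y| := abs_add_le _ _
      _ ≤ _ := by rw [h3]; nlinarith
  intro x hx y hy
  rw [edist_dist, edist_dist, ← ENNReal.ofReal_coe_nnreal, ← ENNReal.ofReal_mul (by positivity)]
  refine ENNReal.ofReal_le_ofReal ?_
  rw [Real.dist_eq, Real.dist_eq]
  push_cast
  rw [Real.norm_eq_abs]
  rcases le_total y x with h | h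
  · exact key x hx y hy h
  · rw [abs_sub_comm, abs_sub_comm (m x + x)]
    exact key y hy x hx h

theorem boundedVariationOn_const_mul_abs_rpow_add {a b : ℝ} (ha : 0 ≤ a) {f r : ℝ → ℝ} {L : ℝ≥0}
    (hr : LipschitzOnWith L r freq) (hf : ∀ x ∈ freq, f x = b * |x| ^ a + r x) :
    BoundedVariationOn f freq := by
  have hL : Icc (-1 / 2 : ℝ) 0 ⊆ freq := Icc_subset_Icc_right (by norm_num)
  have hR : Icc (0 : ℝ) (1 / 2) ⊆ freq := Icc_subset_Icc_left (by norm_num)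
  have habs : ∀ x ∈ freq, |x| ≤ 1 := fun x hx => abs_le.2 ⟨by linarith [hx.1], by linarith [hx.2]⟩
  have hpow : ∀ x ∈ freq, |(|x| ^ a)| ≤ 1 := fun x hx => by
    rw [abs_of_nonneg (by positivity)]
    exact Real.rpow_le_one (abs_nonneg x) (habs x hx) ha
  have h1 : BoundedVariationOn f (Icc (-1 / 2) 0) :=
    -- Left of 0 the power decreases, so both it and its coefficient change sign.
    boundedVariationOn_const_mul_monotone_add (m := fun x => -|x| ^ a) (b := -b) (c := 1) (d := 1)
      (fun x hx y hy hxy => neg_le_neg (Real.rpow_le_rpow (abs_nonneg y) (by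
        rw [abs_of_nonpos hx.2, abs_of_nonpos hy.2]; linarith) ha))
      (fun x hx => by rw [abs_neg]; exact hpow x (hL hx))
      (hr.mono hL) (fun x hx => habs x (hL hx)) (fun x hx => by rw [hf x (hL hx)]; ring)
  have h2 : BoundedVariationOn f (Icc 0 (1 / 2)) :=
    boundedVariationOn_const_mul_monotone_add (m := fun x => |x| ^ a) (b := b) (c := 1) (d := 1)
      (fun x hx y hy hxy => Real.rpow_le_rpow (abs_nonneg x) (by
        rw [abs_of_nonneg hx.1, abs_of_nonneg hy.1]; linarith) ha)
      (fun x hx => hpow x (hR hx))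
      (hr.mono hR) (fun x hx => habs x (hR hx)) (fun x hx => hf x (hR hx))
  have h3 := eVariationOn.Icc_add_Icc f (s := univ) (a := -1 / 2) (b := 0) (c := 1 / 2)
    (by norm_num) (by norm_num) (mem_univ _)
  simp only [univ_inter] at h3
  rw [BoundedVariationOn, freq, ← h3]
  exact ENNReal.add_ne_top.2 ⟨h1, h2⟩

/-! ### Factorization of the spectral ratio. -/

/-- The factor `1 + |x|^{2H+1} ∑_{j ≠ 0} |j + x|^{-(2H+1)}`. -/
def aliasFactor (H x : ℝ) : ℝ := 1 + |x| ^ (2 * H - 1 + 2) * puncturedSeries (2 * H + 1) x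

/-- The smooth factor of the spectral ratio that does not depend on `h`. -/
def smoothFactor (H V x : ℝ) : ℝ :=
  (2 * Real.pi) ^ (1 - 2 * H) / fgnPrefactor H V / Real.sinc (Real.pi * x) ^ (2 * H + 1)

theorem hurstConst_pos {H : ℝ} (hH : H ∈ Ico (1 / 2 : ℝ) 1) : 0 < hurstConst H := by
  have h0 : 0 < H := by linarith [hH.1]
  have hpi := Real.pi_pos
  refine mul_pos (mul_pos (mul_pos (inv_pos.2 hpi) h0) (Real.Gamma_pos_of_pos (by linarith))) ?_
  exact Real.sin_pos_of_pos_of_lt_pi (by positivity) (by nlinarith [hH.2])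

theorem fgnPrefactor_pos {H V : ℝ} (hH : H ∈ Ico (1 / 2 : ℝ) 1) (hV : 0 < V) :
    0 < fgnPrefactor H V :=
  mul_pos (mul_pos hV (Real.rpow_pos_of_pos Real.two_pi_pos _)) (hurstConst_pos hH)

theorem abs_lt_one_of_mem_Ioo {x : ℝ} (hx : x ∈ Ioo (-1 : ℝ) 1) : |x| < 1 := abs_lt.2 ⟨hx.1, hx.2⟩

theorem freq_subset : freq ⊆ Ioo (-1 : ℝ) 1 := fun _ hx =>
  ⟨by linarith [hx.1], by linarith [hx.2]⟩

theorem freq_mem_nhds_zero : freq ∈ 𝓝 (0 : ℝ) := Icc_mem_nhds (by norm_num) (by norm_num)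

theorem neg_mem_freq {x : ℝ} (hx : x ∈ freq) : -x ∈ freq :=
  ⟨by linarith [hx.2], by linarith [hx.1]⟩

theorem uniqueDiffOn_freq : UniqueDiffOn ℝ freq := uniqueDiffOn_Icc (by norm_num)

theorem sinc_pi_mul_pos {x : ℝ} (hx : x ∈ Ioo (-1 : ℝ) 1) : 0 < Real.sinc (Real.pi * x) := by
  refine sinc_pos ?_
  rw [abs_mul, abs_of_pos Real.pi_pos]
  exact mul_lt_of_lt_one_right Real.pi_pos (abs_lt_one_of_mem_Ioo hx)

theorem aliasFactor_pos {H x : ℝ} (hH : 1 / 2 ≤ H) (hx : x ∈ Ioo (-1 : ℝ) 1) :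
    0 < aliasFactor H x := by
  have := puncturedSeries_pos (s := 2 * H + 1) (by linarith) hx
  unfold aliasFactor
  positivity

theorem aliasFactor_neg (H x : ℝ) : aliasFactor H (-x) = aliasFactor H x := by
  simp only [aliasFactor, abs_neg, puncturedSeries_neg]

theorem aliasFactor_zero {H : ℝ} (hH : 1 / 2 ≤ H) : aliasFactor H 0 = 1 := by
  rw [aliasFactor, abs_zero, Real.zero_rpow (by linarith)]
  simp

theorem continuousOn_aliasFactor {H : ℝ} (hH : 1 / 2 ≤ H) :
    ContinuousOn (aliasFactor H) (Ioo (-1) 1) :=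
  continuousOn_const.add ((continuous_abs_rpow (by linarith)).continuousOn.mul
    (contDiffOn_puncturedSeries (by linarith)).continuousOn)

theorem contDiffOn_aliasFactor {H : ℝ} (hH : 1 / 2 ≤ H) :
    ContDiffOn ℝ ∞ (aliasFactor H) (Ioo (-1) 1 \ {0}) := by
  refine contDiffOn_const.add (ContDiffOn.mul ?_
    ((contDiffOn_puncturedSeries (by linarith)).mono sdiff_subset))
  intro x hx
  have hx0 : x ≠ 0 := hx.2
  exact ((contDiffAt_abs hx0).rpow_const_of_ne (abs_ne_zero.2 hx0)).contDiffWithinAt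

theorem smoothFactor_pos {H V x : ℝ} (hH : H ∈ Ico (1 / 2 : ℝ) 1) (hV : 0 < V)
    (hx : x ∈ Ioo (-1 : ℝ) 1) : 0 < smoothFactor H V x :=
  div_pos (div_pos (Real.rpow_pos_of_pos Real.two_pi_pos _) (fgnPrefactor_pos hH hV))
    (Real.rpow_pos_of_pos (sinc_pi_mul_pos hx) _)

theorem smoothFactor_neg (H V x : ℝ) : smoothFactor H V (-x) = smoothFactor H V x := by
  simp only [smoothFactor, mul_neg, Real.sinc_neg]

theorem smoothFactor_zero (H V : ℝ) :
    smoothFactor H V 0 = (2 * Real.pi) ^ (1 - 2 * H) / fgnPrefactor H V := by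
  simp [smoothFactor]

theorem contDiffOn_smoothFactor (H V : ℝ) :
    ContDiffOn ℝ ∞ (smoothFactor H V) (Ioo (-1) 1) := by
  refine contDiffOn_const.div ?_ fun x hx => (Real.rpow_pos_of_pos (sinc_pi_mul_pos hx) _).ne'
  refine ContDiffOn.rpow_const_of_ne ?_ fun x hx => (sinc_pi_mul_pos hx).ne'
  exact (contDiff_sinc.comp (contDiff_const.mul contDiff_id)).contDiffOn

theorem fgnSpectralDensity_eq (H V x : ℝ) :
    fgnSpectralDensity H V x = fgnPrefactor H V * (Real.pi ^ 2)⁻¹ *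
      Real.sin (Real.pi * x) ^ 2 * ∑' j : ℤ, |(j : ℝ) + x| ^ (-(2 * H + 1)) := by
  have hpi := Real.two_pi_pos
  have h : ∀ j : ℤ, |2 * Real.pi * (j : ℝ) + 2 * Real.pi * x| ^ (-(2 * H + 1)) =
      ((2 * Real.pi) ^ (2 * H + 1))⁻¹ * |(j : ℝ) + x| ^ (-(2 * H + 1)) := fun j => by
    rw [← mul_add, abs_mul, abs_of_pos hpi, Real.mul_rpow hpi.le (abs_nonneg _),
      Real.rpow_neg hpi.le]
  have hne : (2 * Real.pi) ^ (2 * H + 1) ≠ 0 := (Real.rpow_pos_of_pos hpi _).ne'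
  simp_rw [fgnSpectralDensity, h, tsum_mul_left]
  field_simp

/-- The exponents of |x| balance: -(2H-1) from f_H, against 2 - (2H+1) from sin² times the term j =
0. -/
theorem rawRatio_eq {H V x : ℝ} (hH : H ∈ Ico (1 / 2 : ℝ) 1) (hV : 0 < V) (h : ℝ → ℝ)
    (hx : x ∈ Ioo (-1 : ℝ) 1) (hx0 : x ≠ 0) :
    rawRatio H V h x = h x * smoothFactor H V x / aliasFactor H x := by
  have hH1 := hH.1
  have hD := aliasFactor_pos hH1 hx
  have hc := fgnPrefactor_pos hH hV
  have hσ := sinc_pi_mul_pos hx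
  have hpi := Real.pi_pos
  have hX : 0 < |x| := abs_pos.2 hx0
  have hsin : Real.sin (Real.pi * x) = Real.pi * x * Real.sinc (Real.pi * x) := by
    rw [Real.sinc_of_ne_zero (by positivity)]
    field_simp
  rw [rawRatio, fracSpectralDensity, fgnSpectralDensity_eq,
    (hasSum_int_abs_rpow (s := 2 * H + 1) (by linarith) hx).tsum_eq, hsin, smoothFactor]
  unfold aliasFactor at hD ⊢
  set w := puncturedSeries (2 * H + 1) x
  set σ := Real.sinc (Real.pi * x)
  set c := fgnPrefactor H V
  have e1 : |2 * (Real.pi * x * σ)| ^ (-(2 * H - 1)) =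
      (2 * Real.pi) ^ (1 - 2 * H) * (|x| ^ (2 * H - 1))⁻¹ * (σ ^ (2 * H - 1))⁻¹ := by
    rw [show 2 * (Real.pi * x * σ) = 2 * Real.pi * x * σ by ring, abs_mul, abs_mul,
      abs_of_pos hσ, abs_of_pos Real.two_pi_pos, Real.mul_rpow (by positivity) hσ.le,
      Real.mul_rpow (by positivity) hX.le, Real.rpow_neg hX.le, Real.rpow_neg hσ.le]
    congr 3
    ring
  have e2 : |x| ^ (-(2 * H + 1)) = (|x| ^ (2 * H - 1) * |x| ^ 2)⁻¹ := by
    rw [Real.rpow_neg hX.le, ← Real.rpow_two, ← Real.rpow_add hX]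
    congr 2
    ring
  have e3 : |x| ^ (2 * H - 1 + 2) = |x| ^ (2 * H - 1) * |x| ^ 2 := by
    rw [Real.rpow_add hX, Real.rpow_two]
  have e4 : σ ^ (2 * H + 1) = σ ^ (2 * H - 1) * σ ^ 2 := by
    rw [← Real.rpow_two, ← Real.rpow_add hσ]
    congr 1
    ring
  rw [e3] at hD
  rw [e1, e2, e3, e4]
  have hxx : x ^ 2 = |x| ^ 2 := (sq_abs x).symm
  simp only [mul_pow, hxx]
  have hy := Real.rpow_pos_of_pos hX (2 * H - 1)
  have hz := Real.rpow_pos_of_pos hσ (2 * H - 1)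
  set y := |x| ^ (2 * H - 1)
  set z := σ ^ (2 * H - 1)
  set X := |x|
  have e5 : (y * X ^ 2)⁻¹ + w = (1 + y * X ^ 2 * w) / (y * X ^ 2) := by
    field_simp
  rw [e5]
  field_simp

theorem continuousOn_factorization {H : ℝ} (V : ℝ) (hH : 1 / 2 ≤ H) {h : ℝ → ℝ}
    (h_cont : ContinuousOn h freq) :
    ContinuousOn (fun x => h x * smoothFactor H V x / aliasFactor H x) freq :=
  (h_cont.mul ((contDiffOn_smoothFactor H V).continuousOn.mono freq_subset)).div
    ((continuousOn_aliasFactor hH).mono freq_subset)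
    fun _ hx => (aliasFactor_pos hH (freq_subset hx)).ne'

theorem tendsto_rawRatio {H V : ℝ} (hH : H ∈ Ico (1 / 2 : ℝ) 1) (hV : 0 < V) {h : ℝ → ℝ}
    (h_cont : ContinuousOn h freq) :
    Tendsto (rawRatio H V h) (𝓝[≠] 0) (𝓝 (h 0 * smoothFactor H V 0 / aliasFactor H 0)) := by
  have hc := (continuousOn_factorization V hH.1 h_cont).continuousAt freq_mem_nhds_zero
  refine (hc.tendsto.mono_left nhdsWithin_le_nhds).congr' ?_
  filter_upwards [self_mem_nhdsWithin, nhdsWithin_le_nhds freq_mem_nhds_zero] with x hx0 hx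
  exact (rawRatio_eq hH hV h (freq_subset hx) hx0).symm

theorem spectralRatio_eqOn {H V : ℝ} (hH : H ∈ Ico (1 / 2 : ℝ) 1) (hV : 0 < V) {h : ℝ → ℝ}
    (h_cont : ContinuousOn h freq) :
    EqOn (spectralRatio H V h) (fun x => h x * smoothFactor H V x / aliasFactor H x) freq := by
  intro x hx
  rcases eq_or_ne x 0 with rfl | hx0
  · rw [spectralRatio, Function.update_self]
    exact (tendsto_rawRatio hH hV h_cont).limUnder_eq
  · rw [spectralRatio, Function.update_of_ne hx0]
    exact rawRatio_eq hH hV h (freq_subset hx) hx0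

theorem spectralRatio_zero {H V : ℝ} (hH : H ∈ Ico (1 / 2 : ℝ) 1) (hV : 0 < V) {h : ℝ → ℝ}
    (h_cont : ContinuousOn h freq) :
    spectralRatio H V h 0 = fracPrefactor H h / fgnPrefactor H V := by
  rw [spectralRatio_eqOn hH hV h_cont (mem_of_mem_nhds freq_mem_nhds_zero)]
  simp only [aliasFactor_zero hH.1, smoothFactor_zero, fracPrefactor]
  ring

theorem fracPrefactor_div_fgnPrefactor {H V : ℝ} (hH : H ∈ Ico (1 / 2 : ℝ) 1) (h : ℝ → ℝ) :
    fracPrefactor H h / fgnPrefactor H V = h 0 / (2 * Real.pi * V * hurstConst H) := by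
  have hpi := Real.two_pi_pos
  have hC := hurstConst_pos hH
  have e : (2 * Real.pi) ^ (2 - 2 * H) = (2 * Real.pi) ^ (1 - 2 * H) * (2 * Real.pi) := by
    rw [← Real.rpow_add_one hpi.ne']
    congr 1
    ring
  have hp := Real.rpow_pos_of_pos hpi (1 - 2 * H)
  rw [fracPrefactor, fgnPrefactor, e]
  field_simp

/-- T is the open interval when h is C³ only there, and the closed one when h is C³ up to the end
points. `hTn` lets derivatives within T serve as derivatives within `freq`. -/
theorem exists_deriv₂_expansion {H V : ℝ} (hH : H ∈ Ico (1 / 2 : ℝ) 1) (hV : 0 < V) {h : ℝ → ℝ}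
    (h_cont : ContinuousOn h freq)
    (h0 : 0 < h 0) {T : Set ℝ} (hTf : T ⊆ freq)
    (hT : UniqueDiffOn ℝ T) (hT0 : T ∈ 𝓝 (0 : ℝ)) (hTn : ∀ x ∈ T, T ∈ 𝓝[freq] x)
    (hh : ContDiffOn ℝ 3 h T) :
    (∀ x ∈ T, HasDerivWithinAt (spectralRatio H V h) (deriv₁ (spectralRatio H V h) x) freq x) ∧
    (∀ x ∈ T, HasDerivWithinAt (deriv₁ (spectralRatio H V h))
      (deriv₂ (spectralRatio H V h) x) freq x) ∧
    ∃ (b : ℝ) (r : ℝ → ℝ), b ≠ 0 ∧ ContDiffOn ℝ 1 r T ∧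
      ∀ x ∈ T, deriv₂ (spectralRatio H V h) x = b * |x| ^ (2 * H - 1) + r x := by
  have hT1 : T ⊆ Ioo (-1) 1 := hTf.trans freq_subset
  have hw : 1 < 2 * H + 1 := by linarith [hH.1]
  have hle : (3 : WithTop ℕ∞) ≤ ((⊤ : ℕ∞) : WithTop ℕ∞) :=
    WithTop.coe_le_coe.2 (le_top : (3 : ℕ∞) ≤ ⊤)
  obtain ⟨g₁, g₂, r, hg1, hg2, hr, he⟩ := exists_second_deriv_expansion (a := 2 * H - 1)
    (by linarith [hH.1]) hT hT0
    (hh.mul (((contDiffOn_smoothFactor H V).mono hT1).of_le hle))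
    (((contDiffOn_puncturedSeries hw).mono hT1).of_le hle)
    fun x hx => (aliasFactor_pos hH.1 (hT1 hx)).ne'
  set g := spectralRatio H V h
  have hu : ∀ x ∈ T, UniqueDiffWithinAt ℝ freq x := fun x hx => uniqueDiffOn_freq x (hTf hx)
  have heq := (spectralRatio_eqOn hH hV h_cont).mono hTf
  have d1 : ∀ x ∈ T, HasDerivWithinAt g (g₁ x) freq x := fun x hx =>
    ((hg1 x hx).congr heq (heq hx)).mono_of_mem_nhdsWithin (hTn x hx)
  have e1 : ∀ x ∈ T, deriv₁ g x = g₁ x := fun x hx => (d1 x hx).derivWithin (hu x hx)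
  have d2 : ∀ x ∈ T, HasDerivWithinAt (deriv₁ g) (g₂ x) freq x := fun x hx =>
    ((hg2 x hx).congr e1 (e1 x hx)).mono_of_mem_nhdsWithin (hTn x hx)
  have e2 : ∀ x ∈ T, deriv₂ g x = g₂ x := fun x hx => (d2 x hx).derivWithin (hu x hx)
  have hz := mem_of_mem_nhds hT0
  refine ⟨fun x hx => e1 x hx ▸ d1 x hx, fun x hx => e2 x hx ▸ d2 x hx, _, r, ?_, hr,
    fun x hx => (e2 x hx).trans (he x hx)⟩
  have p1 := smoothFactor_pos hH hV (hT1 hz)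
  have p2 := puncturedSeries_pos hw (hT1 hz)
  have p3 : 0 < 2 * H - 1 + 1 := by linarith [hH.1]
  have p4 : 0 < 2 * H - 1 + 2 := by linarith [hH.1]
  exact (neg_neg_of_pos (by positivity)).ne

/-! ### Fourier coefficients of |x|^a and of C¹ functions. -/

/-- Split at δ = 1/θ. Below δ, |sin| ≤ 1 gives δ^a / a; above it, an integration by parts gains 1/θ,
and δ^(a-1)/θ = θ^(-a). -/
theorem abs_integral_rpow_mul_sin_le {a θ B : ℝ} (ha : 0 < a) (ha1 : a < 1) (hθ : 0 < θ)
    (hB : θ⁻¹ ≤ B) :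
    |∫ x in (0 : ℝ)..B, x ^ (a - 1) * Real.sin (θ * x)| ≤ (1 / a + 2) * θ ^ (-a) := by
  set δ := θ⁻¹ with hδ
  have hδ0 : 0 < δ := inv_pos.2 hθ
  have hB0 : 0 < B := hδ0.trans_le hB
  have hδa : δ ^ a = θ ^ (-a) := by rw [hδ, Real.inv_rpow hθ.le, Real.rpow_neg hθ.le]
  have hδa1 : δ ^ (a - 1) / θ = θ ^ (-a) := by
    rw [← hδa, Real.rpow_sub_one hδ0.ne', hδ]
    field_simp
  have hii : ∀ u v : ℝ, IntervalIntegrable (fun x : ℝ => x ^ (a - 1)) volume u v := fun u v =>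
    intervalIntegral.intervalIntegrable_rpow' (by linarith)
  have hint : ∀ u v : ℝ,
      IntervalIntegrable (fun x : ℝ => x ^ (a - 1) * Real.sin (θ * x)) volume u v := fun u v =>
    (hii u v).mul_continuousOn (by fun_prop)
  rw [← intervalIntegral.integral_add_adjacent_intervals (hint 0 δ) (hint δ B)]
  have h1 : |∫ x in (0 : ℝ)..δ, x ^ (a - 1) * Real.sin (θ * x)| ≤ 1 / a * θ ^ (-a) := by
    have := intervalIntegral.norm_integral_le_of_norm_le (μ := volume) hδ0.le
      (f := fun x : ℝ => x ^ (a - 1) * Real.sin (θ * x)) (g := fun x : ℝ => x ^ (a - 1))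
      (ae_of_all _ fun x hx => by
        rw [norm_mul, Real.norm_of_nonneg (Real.rpow_nonneg hx.1.le _)]
        exact mul_le_of_le_one_right (Real.rpow_nonneg hx.1.le _) (Real.abs_sin_le_one _))
      (hii 0 δ)
    rw [integral_rpow (Or.inl (by linarith)), sub_add_cancel, Real.zero_rpow ha.ne', sub_zero,
      hδa, Real.norm_eq_abs] at this
    rw [one_div_mul_eq_div]
    exact this
  have hpos : ∀ x ∈ uIcc δ B, 0 < x := fun x hx => by
    rw [uIcc_of_le hB] at hx
    exact hδ0.trans_le hx.1
  have hcont : ∀ c : ℝ, ContinuousOn (fun x : ℝ => x ^ c) (uIcc δ B) := fun c x hx =>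
    (Real.continuousAt_rpow_const x c (Or.inl (hpos x hx).ne')).continuousWithinAt
  have hparts := intervalIntegral.integral_mul_deriv_eq_deriv_mul (a := δ) (b := B)
    (u := fun x => x ^ (a - 1)) (v := fun x => -Real.cos (θ * x) / θ)
    (u' := fun x => (a - 1) * x ^ (a - 1 - 1)) (v' := fun x => Real.sin (θ * x))
    (fun x hx => Real.hasDerivAt_rpow_const (Or.inl (hpos x hx).ne'))
    (fun x _ => by
      have h := (((hasDerivAt_id x).const_mul θ).cos.neg.div_const θ)
      refine h.congr_deriv ?_
      simp only [id]
      field_simp)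
    ((continuousOn_const.mul (hcont _)).intervalIntegrable)
    (Continuous.intervalIntegrable (by fun_prop) _ _)
  have h2 : |∫ x in δ..B, (a - 1) * x ^ (a - 1 - 1) * (-Real.cos (θ * x) / θ)| ≤
      (δ ^ (a - 1) - B ^ (a - 1)) / θ := by
    have := intervalIntegral.norm_integral_le_of_norm_le (μ := volume) hB
      (f := fun x : ℝ => (a - 1) * x ^ (a - 1 - 1) * (-Real.cos (θ * x) / θ))
      (g := fun x : ℝ => (1 - a) / θ * x ^ (a - 1 - 1))
      (ae_of_all _ fun x hx => by
        have hx0 : 0 < x := hδ0.trans hx.1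
        have hp := Real.rpow_nonneg hx0.le (a - 1 - 1)
        have hc := Real.abs_cos_le_one (θ * x)
        rw [norm_mul, norm_mul, norm_div, norm_neg, Real.norm_of_nonneg hp,
          Real.norm_of_nonneg hθ.le, Real.norm_of_nonpos (by linarith : a - 1 ≤ 0),
          Real.norm_eq_abs]
        have : (1 - a) * x ^ (a - 1 - 1) * (|Real.cos (θ * x)| / θ) ≤
            (1 - a) * x ^ (a - 1 - 1) * (1 / θ) :=
          mul_le_mul_of_nonneg_left (by gcongr) (mul_nonneg (by linarith) hp)
        calc _ = (1 - a) * x ^ (a - 1 - 1) * (|Real.cos (θ * x)| / θ) := by ring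
          _ ≤ _ := this
          _ = _ := by ring)
      ((continuousOn_const.mul (hcont _)).intervalIntegrable)
    rw [intervalIntegral.integral_const_mul, integral_rpow (Or.inr ⟨by linarith, fun h0 =>
      (hpos 0 h0).false⟩), sub_add_cancel, Real.norm_eq_abs] at this
    refine this.trans_eq ?_
    have : a - 1 ≠ 0 := by linarith
    field_simp
    ring
  have h3 : |∫ x in δ..B, x ^ (a - 1) * Real.sin (θ * x)| ≤ 2 * θ ^ (-a) := by
    rw [hparts]
    have key : ∀ x : ℝ, 0 < x → |x ^ (a - 1) * (-Real.cos (θ * x) / θ)| ≤ x ^ (a - 1) / θ := by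
      intro x hx
      have hp := Real.rpow_nonneg hx.le (a - 1)
      rw [abs_mul, abs_of_nonneg hp, abs_div, abs_neg, abs_of_pos hθ, ← mul_div_assoc]
      have := mul_le_of_le_one_right hp (Real.abs_cos_le_one (θ * x))
      gcongr
    have k1 := key B hB0
    have k2 := key δ hδ0
    -- The boundary term at B cancels the -B^(a-1)/θ in `h2`, leaving 2 δ^(a-1)/θ.
    have t1 := abs_sub (B ^ (a - 1) * (-Real.cos (θ * B) / θ) -
      δ ^ (a - 1) * (-Real.cos (θ * δ) / θ))
      (∫ x in δ..B, (a - 1) * x ^ (a - 1 - 1) * (-Real.cos (θ * x) / θ))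
    have t2 := abs_sub (B ^ (a - 1) * (-Real.cos (θ * B) / θ))
      (δ ^ (a - 1) * (-Real.cos (θ * δ) / θ))
    rw [sub_div] at h2
    linarith
  refine (abs_add_le _ _).trans ?_
  rw [add_mul]
  exact add_le_add h1 h3

/-- Integration by parts; x^(a-1) may blow up at 0, so the derivative is used only on the open
interval. -/
theorem integral_cos_mul_rpow {a θ B : ℝ} (ha : 0 < a) (hθ : 0 < θ) (hB : 0 ≤ B)
    (hsin : Real.sin (θ * B) = 0) :
    ∫ x in (0 : ℝ)..B, x ^ a * Real.cos (θ * x) =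
      -(a / θ) * ∫ x in (0 : ℝ)..B, x ^ (a - 1) * Real.sin (θ * x) := by
  have hparts := intervalIntegral.integral_mul_deriv_eq_deriv_mul_of_hasDerivAt (a := 0) (b := B)
    (u := fun x => x ^ a) (v := fun x => Real.sin (θ * x) / θ)
    (u' := fun x => a * x ^ (a - 1)) (v' := fun x => Real.cos (θ * x))
    (fun x _ => (Real.continuousAt_rpow_const x a (Or.inr ha.le)).continuousWithinAt)
    (by fun_prop)
    (fun x hx => by
      rw [min_eq_left hB] at hx
      exact Real.hasDerivAt_rpow_const (Or.inl hx.1.ne'))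
    (fun x _ => by
      have h := (((hasDerivAt_id x).const_mul θ).sin.div_const θ)
      refine h.congr_deriv ?_
      simp only [id]
      field_simp)
    ((intervalIntegral.intervalIntegrable_rpow' (by linarith)).const_mul a)
    (Continuous.intervalIntegrable (by fun_prop) _ _)
  rw [hparts, hsin, Real.zero_rpow ha.ne', ← intervalIntegral.integral_const_mul]
  simp only [zero_div, mul_zero, zero_mul, sub_self, zero_sub]
  rw [← intervalIntegral.integral_neg]
  refine intervalIntegral.integral_congr fun x _ => ?_
  ring

theorem fourierCoefficient_eq_integral (φ : ℝ → ℝ) (n : ℤ) :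
    fourierCoefficient φ n =
      ∫ x in (-1 / 2 : ℝ)..1 / 2, Complex.exp (-(2 * Real.pi * n * x : ℝ) * Complex.I) * φ x := by
  rw [fourierCoefficient, fourierCoeffOn_eq_integral,
    show (1 / (1 / 2 - -1 / 2) : ℝ) = 1 by norm_num, one_smul]
  refine intervalIntegral.integral_congr fun x _ => ?_
  simp only [fourier_coe_apply, smul_eq_mul]
  congr 2
  push_cast
  ring

theorem fourierCoefficient_eq_cos_of_even {φ : ℝ → ℝ} (hc : Continuous φ)
    (he : ∀ x, φ (-x) = φ x) (n : ℤ) :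
    fourierCoefficient φ n =
      ((2 * ∫ x in (0 : ℝ)..1 / 2, φ x * Real.cos (2 * Real.pi * |(n : ℝ)| * x) : ℝ) : ℂ) := by
  set f : ℝ → ℂ := fun x => Complex.exp (-(2 * Real.pi * n * x : ℝ) * Complex.I) * φ x with hf
  have hfc : Continuous f := by
    have : Continuous fun x : ℝ => (φ x : ℂ) := Complex.continuous_ofReal.comp hc
    fun_prop
  rw [fourierCoefficient_eq_integral, ← intervalIntegral.integral_add_adjacent_intervals
    (hfc.intervalIntegrable (-1 / 2) 0) (hfc.intervalIntegrable 0 (1 / 2))]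
  have h1 : ∫ x in (-1 / 2 : ℝ)..0, f x = ∫ x in (0 : ℝ)..1 / 2, f (-x) := by
    rw [intervalIntegral.integral_comp_neg]
    norm_num
  have hfc' : Continuous fun x => f (-x) := hfc.comp continuous_neg
  rw [h1, ← intervalIntegral.integral_add (hfc'.intervalIntegrable _ _)
    (hfc.intervalIntegrable _ _), ← intervalIntegral.integral_const_mul,
    ← intervalIntegral.integral_ofReal]
  refine intervalIntegral.integral_congr fun x _ => ?_
  have hcos : Real.cos (2 * Real.pi * |(n : ℝ)| * x) = Real.cos (2 * Real.pi * n * x) := by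
    rcases abs_choice (n : ℝ) with h | h <;> rw [h]
    rw [← Real.cos_neg]
    congr 1
    ring
  simp only [hf, he, hcos]
  push_cast
  rw [Complex.cos]
  have e : -(2 * (Real.pi : ℂ) * n * -x) = 2 * Real.pi * n * x := by ring
  rw [e, neg_mul]
  ring

theorem norm_fourierCoefficient_abs_rpow_le {a : ℝ} (ha : 0 < a) (ha1 : a < 1) {n : ℤ}
    (hn : n ≠ 0) :
    ‖fourierCoefficient (fun x => |x| ^ a) n‖ ≤
      2 * (a * (1 / a + 2)) * (2 * Real.pi * |(n : ℝ)|) ^ (-(1 + a)) := by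
  have hn1 : (1 : ℝ) ≤ |(n : ℝ)| := by exact_mod_cast Int.one_le_abs hn
  have hpi := Real.pi_gt_three
  set θ := 2 * Real.pi * |(n : ℝ)| with hθ
  have hθ0 : 0 < θ := by positivity
  have hθ2 : 2 ≤ θ := by nlinarith
  rw [fourierCoefficient_eq_cos_of_even (continuous_abs_rpow ha.le) (fun x => by rw [abs_neg]),
    Complex.norm_real, Real.norm_eq_abs, abs_mul, abs_two]
  have e : ∫ x in (0 : ℝ)..1 / 2, |x| ^ a * Real.cos (θ * x) =
      ∫ x in (0 : ℝ)..1 / 2, x ^ a * Real.cos (θ * x) := by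
    refine intervalIntegral.integral_congr fun x hx => ?_
    rw [uIcc_of_le (by norm_num)] at hx
    simp only [abs_of_nonneg hx.1]
  -- θ/2 = π|n|, so the boundary term at 1/2 vanishes.
  have hs : Real.sin (θ * (1 / 2)) = 0 := by
    have : θ * (1 / 2) = ((|n| : ℤ) : ℝ) * Real.pi := by
      rw [hθ]
      push_cast
      ring
    rw [this, Real.sin_int_mul_pi]
  rw [e, integral_cos_mul_rpow ha hθ0 (by norm_num) hs, abs_mul, abs_neg,
    abs_of_pos (div_pos ha hθ0)]
  have hb := abs_integral_rpow_mul_sin_le ha ha1 hθ0 (B := 1 / 2) (by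
    rw [one_div]; exact inv_anti₀ (by norm_num) hθ2)
  calc 2 * (a / θ * |∫ x in (0 : ℝ)..1 / 2, x ^ (a - 1) * Real.sin (θ * x)|)
      ≤ 2 * (a / θ * ((1 / a + 2) * θ ^ (-a))) := by gcongr
    _ = _ := by
      rw [show -(1 + a) = -a - 1 by ring, Real.rpow_sub_one hθ0.ne']
      ring

theorem fourierCoefficient_of_hasDerivAt {φ φ' : ℝ → ℝ} (hc : ContinuousOn φ freq)
    (hd : ∀ x ∈ Ioo (-1 / 2 : ℝ) (1 / 2), HasDerivAt φ (φ' x) x) (hc' : ContinuousOn φ' freq)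
    (hper : φ (1 / 2) = φ (-1 / 2)) {n : ℤ} (hn : n ≠ 0) :
    fourierCoefficient φ n = (2 * Real.pi * Complex.I * n)⁻¹ * fourierCoefficient φ' n := by
  have h12 : (-1 / 2 : ℝ) ≤ 1 / 2 := by norm_num
  have := fourierCoeffOn_of_hasDerivAt_Ioo (show (-1 / 2 : ℝ) < 1 / 2 by norm_num) hn
    (f := fun x => (φ x : ℂ)) (f' := fun x => (φ' x : ℂ))
    (by rw [uIcc_of_le h12]; exact Complex.continuous_ofReal.comp_continuousOn hc)
    (by rw [min_eq_left h12, max_eq_right h12]; exact fun x hx => (hd x hx).ofReal_comp)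
    (ContinuousOn.intervalIntegrable (by
      rw [uIcc_of_le h12]; exact Complex.continuous_ofReal.comp_continuousOn hc'))
  rw [fourierCoefficient, this, hper, fourierCoefficient]
  have hpi : (Real.pi : ℂ) ≠ 0 := by exact_mod_cast Real.pi_ne_zero
  have hn' : (n : ℂ) ≠ 0 := by exact_mod_cast hn
  have hI := Complex.I_ne_zero
  push_cast
  field_simp
  ring

theorem norm_two_pi_I_mul_inv (n : ℤ) :
    ‖(2 * Real.pi * Complex.I * n : ℂ)⁻¹‖ = (2 * Real.pi)⁻¹ * |(n : ℝ)|⁻¹ := by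
  rw [norm_inv, ← mul_inv]
  simp [abs_of_pos Real.pi_pos]

theorem summable_sq_norm_fourierCoefficient {φ : ℝ → ℝ} (hc : ContinuousOn φ freq) :
    Summable fun n => ‖fourierCoefficient φ n‖ ^ 2 := by
  refine (hasSum_sq_fourierCoeffOn (f := fun x => (φ x : ℂ)) (by norm_num) ?_).summable
  have hcc : ContinuousOn (fun x => (φ x : ℂ)) freq := Complex.continuous_ofReal.comp_continuousOn hc
  obtain ⟨M, hM⟩ := isCompact_Icc.exists_bound_of_continuousOn hcc
  refine MemLp.of_bound ((hcc.mono Ioc_subset_Icc_self).aestronglyMeasurable measurableSet_Ioc) M ?_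
  filter_upwards [ae_restrict_mem measurableSet_Ioc] with x hx
  exact hM x (Ioc_subset_Icc_self hx)

/-- One integration by parts gives 1/|n| times a coefficient of r'. These are square summable since
r' is continuous, so 2uv ≤ u² + v² yields summability, and boundedness yields the O(1/n) bound. -/
theorem fourierCoefficient_of_contDiffOn {r : ℝ → ℝ} (hr : ContDiffOn ℝ 1 r freq)
    (hper : r (1 / 2) = r (-1 / 2)) :
    Summable (fun n => ‖fourierCoefficient r n‖) ∧
      ∃ C, ∀ n : ℤ, n ≠ 0 → ‖fourierCoefficient r n‖ ≤ C * |(n : ℝ)|⁻¹ := by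
  have hc' := hr.continuousOn_derivWithin uniqueDiffOn_freq le_rfl
  have hsq := summable_sq_norm_fourierCoefficient hc'
  have hd : ∀ x ∈ Ioo (-1 / 2 : ℝ) (1 / 2), HasDerivAt r (derivWithin r freq x) x := fun x hx =>
    (hr.differentiableOn one_ne_zero x (Ioo_subset_Icc_self hx)).hasDerivWithinAt.hasDerivAt
      (Icc_mem_nhds hx.1 hx.2)
  have heq : ∀ n : ℤ, n ≠ 0 → ‖fourierCoefficient r n‖ =
      (2 * Real.pi)⁻¹ * |(n : ℝ)|⁻¹ * ‖fourierCoefficient (derivWithin r freq) n‖ := fun n hn => by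
    rw [fourierCoefficient_of_hasDerivAt hr.continuousOn hd hc' hper hn, norm_mul,
      norm_two_pi_I_mul_inv]
  have hpi : (2 * Real.pi)⁻¹ ≤ 1 := inv_le_one_of_one_le₀ (by linarith [Real.pi_gt_three])
  have hle : ∀ n : ℤ, n ≠ 0 → ‖fourierCoefficient r n‖ ≤
      ‖fourierCoefficient (derivWithin r freq) n‖ * |(n : ℝ)|⁻¹ := fun n hn => by
    rw [heq n hn, mul_assoc]
    calc _ ≤ 1 * (|(n : ℝ)|⁻¹ * ‖fourierCoefficient (derivWithin r freq) n‖) := by gcongr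
      _ = _ := by ring
  constructor
  · have hinv : Summable fun n : ℤ => (|(n : ℝ)|⁻¹) ^ 2 := by
      have := Real.summable_one_div_int_pow (p := 2) |>.2 one_lt_two
      refine this.congr fun n => ?_
      rw [inv_pow, sq_abs, one_div]
    refine Summable.of_norm_bounded_eventually (hsq.add hinv) ?_
    filter_upwards [(finite_singleton (0 : ℤ)).compl_mem_cofinite] with n hn
    rw [norm_norm]
    refine (hle n hn).trans ?_
    have := two_mul_le_add_sq ‖fourierCoefficient (derivWithin r freq) n‖ |(n : ℝ)|⁻¹
    have h0 : 0 ≤ ‖fourierCoefficient (derivWithin r freq) n‖ * |(n : ℝ)|⁻¹ := by positivity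
    linarith
  · refine ⟨√(∑' n, ‖fourierCoefficient (derivWithin r freq) n‖ ^ 2), fun n hn =>
      (hle n hn).trans ?_⟩
    gcongr
    exact Real.le_sqrt_of_sq_le (hsq.le_tsum n fun _ _ => by positivity)

theorem fourierCoefficient_abs_rpow {a : ℝ} (ha : 0 ≤ a) (ha1 : a < 1) :
    Summable (fun n => ‖fourierCoefficient (fun x => |x| ^ a) n‖) ∧
      ∃ C, ∀ n : ℤ, n ≠ 0 → ‖fourierCoefficient (fun x => |x| ^ a) n‖ ≤ C * |(n : ℝ)|⁻¹ := by
  rcases ha.eq_or_lt with rfl | ha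
  -- For a = 0 the power is the constant 1, covered by the C¹ case.
  · simp only [Real.rpow_zero]
    exact fourierCoefficient_of_contDiffOn contDiffOn_const rfl
  have hpi := Real.two_pi_pos
  set K := 2 * (a * (1 / a + 2)) * (2 * Real.pi) ^ (-(1 + a))
  have hK : 0 ≤ K := by positivity
  have hle : ∀ n : ℤ, n ≠ 0 → ‖fourierCoefficient (fun x => |x| ^ a) n‖ ≤
      K * |(n : ℝ)| ^ (-(1 + a)) := fun n hn => by
    refine (norm_fourierCoefficient_abs_rpow_le ha ha1 hn).trans_eq ?_
    rw [Real.mul_rpow hpi.le (abs_nonneg _), ← mul_assoc]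
  constructor
  · have hs : Summable fun n : ℤ => |(n : ℝ)| ^ (-(1 + a)) :=
      Real.summable_abs_int_rpow (by linarith)
    refine Summable.of_norm_bounded_eventually (hs.mul_left K) ?_
    filter_upwards [(finite_singleton (0 : ℤ)).compl_mem_cofinite] with n hn
    rw [norm_norm]
    exact hle n hn
  · refine ⟨K, fun n hn => (hle n hn).trans ?_⟩
    have hn1 : (1 : ℝ) ≤ |(n : ℝ)| := by exact_mod_cast Int.one_le_abs hn
    rw [← Real.rpow_neg_one]
    gcongr
    · linarith

theorem fourierCoefficient_const_mul_add {φ ψ : ℝ → ℝ} (hφ : ContinuousOn φ freq)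
    (hψ : ContinuousOn ψ freq) (b : ℝ) {f : ℝ → ℝ} (hf : ∀ x ∈ freq, f x = b * φ x + ψ x)
    (n : ℤ) :
    fourierCoefficient f n = b * fourierCoefficient φ n + fourierCoefficient ψ n := by
  have h12 : (-1 / 2 : ℝ) ≤ 1 / 2 := by norm_num
  have hi : ∀ {φ : ℝ → ℝ}, ContinuousOn φ freq → IntervalIntegrable (fun x : ℝ =>
      Complex.exp (-(2 * Real.pi * n * x : ℝ) * Complex.I) * φ x) volume (-1 / 2) (1 / 2) :=
    fun {φ} h => by
      refine ContinuousOn.intervalIntegrable ?_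
      rw [uIcc_of_le h12]
      exact ContinuousOn.mul (by fun_prop) (Complex.continuous_ofReal.comp_continuousOn h)
  simp only [fourierCoefficient_eq_integral]
  rw [← intervalIntegral.integral_const_mul, ← intervalIntegral.integral_add
    ((hi hφ).const_mul _) (hi hψ)]
  refine intervalIntegral.integral_congr fun x hx => ?_
  rw [uIcc_of_le h12] at hx
  simp only [hf x hx]
  push_cast
  ring

theorem hasSum_fourierCoefficient {φ : ℝ → ℝ} (hc : ContinuousOn φ freq)
    (hper : φ (1 / 2) = φ (-1 / 2)) (hs : Summable fun n => ‖fourierCoefficient φ n‖)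
    {x : ℝ} (hx : x ∈ freq) :
    HasSum (fun j : ℤ => fourierCoefficient φ j *
      Complex.exp (2 * Real.pi * Complex.I * j * x)) (φ x : ℂ) := by
  have : Fact ((0 : ℝ) < 1) := ⟨one_pos⟩
  have e12 : (-1 / 2 : ℝ) + 1 = 1 / 2 := by norm_num
  have hcont : Continuous (AddCircle.liftIco (1 : ℝ) (-1 / 2) fun x => (φ x : ℂ)) :=
    AddCircle.liftIco_continuous (by rw [e12, hper])
      (by rw [e12]; exact Complex.continuous_ofReal.comp_continuousOn hc)
  have hco : ∀ n, fourierCoeff (AddCircle.liftIco (1 : ℝ) (-1 / 2) fun x => (φ x : ℂ)) n =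
      fourierCoefficient φ n := fun n => by
    rw [fourierCoeff_liftIco_eq, fourierCoefficient, fourierCoeffOn_eq_integral,
      fourierCoeffOn_eq_integral]
    simp only [fourier_coe_apply, e12]
  have h := has_pointwise_sum_fourier_series_of_summable (f := ⟨_, hcont⟩)
    ((summable_congr hco).2 hs.of_norm) (x : AddCircle (1 : ℝ))
  simp only [ContinuousMap.coe_mk, hco, fourier_coe_apply, smul_eq_mul] at h
  have hval : AddCircle.liftIco (1 : ℝ) (-1 / 2) (fun x => (φ x : ℂ)) (x : AddCircle (1 : ℝ)) =
      φ x := by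
    -- The lift uses the half-open interval, so 1/2 is identified with -1/2 on the circle.
    rcases hx.2.lt_or_eq with hlt | heq
    · exact AddCircle.liftIco_coe_apply ⟨hx.1, by rw [e12]; exact hlt⟩
    · have : ((x : ℝ) : AddCircle (1 : ℝ)) = ((-1 / 2 : ℝ) : AddCircle (1 : ℝ)) := by
        rw [heq, ← e12, AddCircle.coe_add_period]
      rw [this, AddCircle.liftIco_coe_apply ⟨le_rfl, by norm_num⟩, heq, hper]
  rw [hval] at h
  simpa using h

/-! ### Symmetry about 1/2 and vanishing boundary terms. -/

/-- Restores the form with sin πx and the full series, each of which is visibly invariant under x ↦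
1 - x. -/
theorem smoothFactor_div_aliasFactor_eq {H V x : ℝ} (hH : 1 / 2 ≤ H) (hx : x ∈ Ioo (0 : ℝ) 1) :
    smoothFactor H V x / aliasFactor H x = (2 * Real.pi) ^ (1 - 2 * H) / fgnPrefactor H V /
      ((Real.sin (Real.pi * x) / Real.pi) ^ (2 * H + 1) *
        ∑' j : ℤ, |(j : ℝ) + x| ^ (-(2 * H + 1))) := by
  have hpi := Real.pi_pos
  have hx0 := hx.1
  have hsin : 0 < Real.sin (Real.pi * x) :=
    Real.sin_pos_of_pos_of_lt_pi (by positivity) (mul_lt_of_lt_one_right hpi hx.2)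
  rw [(hasSum_int_abs_rpow (s := 2 * H + 1) (by linarith) ⟨by linarith, hx.2⟩).tsum_eq,
    smoothFactor, aliasFactor, div_div, show 2 * H - 1 + 2 = 2 * H + 1 by ring,
    Real.sinc_of_ne_zero (by positivity), abs_of_pos hx0, Real.rpow_neg hx0.le,
    ← div_div (Real.sin (Real.pi * x)) Real.pi x, Real.div_rpow (div_pos hsin hpi).le hx0.le]
  have hp := Real.rpow_pos_of_pos hx0 (2 * H + 1)
  congr 1
  field_simp

theorem smoothFactor_div_aliasFactor_one_sub {H V x : ℝ} (hH : 1 / 2 ≤ H)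
    (hx : x ∈ Ioo (0 : ℝ) 1) :
    smoothFactor H V (1 - x) / aliasFactor H (1 - x) = smoothFactor H V x / aliasFactor H x := by
  rw [smoothFactor_div_aliasFactor_eq hH hx, smoothFactor_div_aliasFactor_eq hH
    ⟨by linarith [hx.2], by linarith [hx.1]⟩, tsum_int_abs_rpow_one_sub, mul_sub, mul_one,
    Real.sin_pi_sub]

theorem contDiffOn_smoothFactor_div_aliasFactor {H : ℝ} (V : ℝ) (hH : 1 / 2 ≤ H) :
    ContDiffOn ℝ ((⊤ : ℕ∞) : WithTop ℕ∞) (fun x => smoothFactor H V x / aliasFactor H x)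
      (Ioo (-1) 1 \ {0}) :=
  ((contDiffOn_smoothFactor H V).mono sdiff_subset).div (contDiffOn_aliasFactor hH)
    fun _ hx => (aliasFactor_pos hH hx.1).ne'

/-- By symmetry the derivative at 1/2 equals its own negative. Two-sided differentiability holds
because the factors are smooth beyond `freq`. -/
theorem hasDerivAt_smoothFactor_div_aliasFactor_half {H : ℝ} (V : ℝ) (hH : 1 / 2 ≤ H) :
    HasDerivAt (fun x => smoothFactor H V x / aliasFactor H x) 0 (1 / 2) := by
  have hmem : Ioo (-1 : ℝ) 1 \ {0} ∈ 𝓝 (1 / 2 : ℝ) :=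
    (isOpen_Ioo.sdiff isClosed_singleton).mem_nhds ⟨⟨by norm_num, by norm_num⟩, by norm_num⟩
  have hd : DifferentiableAt ℝ (fun x => smoothFactor H V x / aliasFactor H x) (1 / 2) :=
    ((contDiffOn_smoothFactor_div_aliasFactor V hH).contDiffAt hmem).differentiableAt (by simp)
  have h1 := deriv_comp_const_sub (f := fun x => smoothFactor H V x / aliasFactor H x) 1 (1 / 2)
  have h2 : deriv (fun x => smoothFactor H V (1 - x) / aliasFactor H (1 - x)) (1 / 2) =
      deriv (fun x => smoothFactor H V x / aliasFactor H x) (1 / 2) := by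
    refine Filter.EventuallyEq.deriv_eq ?_
    filter_upwards [Ioo_mem_nhds (a := (0 : ℝ)) (b := 1) (x := 1 / 2) (by norm_num) (by norm_num)]
      with x hx
    exact smoothFactor_div_aliasFactor_one_sub hH hx
  rw [h2, show (1 - 1 / 2 : ℝ) = 1 / 2 by norm_num] at h1
  have h3 : deriv (fun x => smoothFactor H V x / aliasFactor H x) (1 / 2) = 0 := by linarith
  exact h3 ▸ hd.hasDerivAt

/-- Used with c = 1 (g even, so g' odd) and c = -1 (g' odd, so g'' even). -/
theorem derivWithin_freq_neg {φ : ℝ → ℝ} {c : ℝ} (h : ∀ x ∈ freq, φ (-x) = c * φ x)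
    {x : ℝ} (hx : x ∈ freq) : derivWithin φ freq (-x) = -c * derivWithin φ freq x := by
  have h1 := derivWithin_comp_neg (f := φ) (s := freq) (x := x)
  have hneg : -freq = freq := by
    simp only [freq, neg_Icc]
    norm_num
  rw [hneg, derivWithin_congr h (h x hx), derivWithin_const_mul_field] at h1
  linarith

theorem norm_fourierCoefficient_le_of_deriv {φ φ₁ φ₂ : ℝ → ℝ}
    (h1 : ∀ x ∈ freq, HasDerivWithinAt φ (φ₁ x) freq x)
    (h2 : ∀ x ∈ freq, HasDerivWithinAt φ₁ (φ₂ x) freq x) (hc : ContinuousOn φ₂ freq)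
    (hp : φ (1 / 2) = φ (-1 / 2)) (hp1 : φ₁ (1 / 2) = φ₁ (-1 / 2)) {n : ℤ} (hn : n ≠ 0) :
    ‖fourierCoefficient φ n‖ ≤ (|(n : ℝ)| ^ 2)⁻¹ * ‖fourierCoefficient φ₂ n‖ := by
  have hd : ∀ {φ φ' : ℝ → ℝ}, (∀ x ∈ freq, HasDerivWithinAt φ (φ' x) freq x) →
      ∀ x ∈ Ioo (-1 / 2 : ℝ) (1 / 2), HasDerivAt φ (φ' x) x := fun h x hx =>
    (h x (Ioo_subset_Icc_self hx)).hasDerivAt (Icc_mem_nhds hx.1 hx.2)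
  rw [fourierCoefficient_of_hasDerivAt (fun x hx => (h1 x hx).continuousWithinAt) (hd h1)
    (fun x hx => (h2 x hx).continuousWithinAt) hp hn, fourierCoefficient_of_hasDerivAt
    (fun x hx => (h2 x hx).continuousWithinAt) (hd h2) hc hp1 hn, norm_mul, norm_mul,
    norm_two_pi_I_mul_inv]
  have hpi : (2 * Real.pi)⁻¹ ≤ 1 := inv_le_one_of_one_le₀ (by linarith [Real.pi_gt_three])
  have hpi0 : 0 ≤ (2 * Real.pi)⁻¹ := by positivity
  calc _ = (2 * Real.pi)⁻¹ * (2 * Real.pi)⁻¹ *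
        ((|(n : ℝ)| ^ 2)⁻¹ * ‖fourierCoefficient φ₂ n‖) := by ring
    _ ≤ _ := mul_le_of_le_one_left (by positivity) (mul_le_one₀ hpi hpi0 hpi)

/-- Summability and decay of a sequence dominated by `n⁻²` times a summable `O(1/n)` sequence. -/
theorem summable_isBigO_of_norm_le {G F : ℤ → ℂ} {C : ℝ}
    (hGF : ∀ n : ℤ, n ≠ 0 → ‖G n‖ ≤ (|(n : ℝ)| ^ 2)⁻¹ * ‖F n‖)
    (hF : Summable fun n => ‖F n‖) (hC : ∀ n : ℤ, n ≠ 0 → ‖F n‖ ≤ C * |(n : ℝ)|⁻¹) :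
    Summable (fun j : ℤ => (j : ℝ) ^ 2 * ‖G j‖) ∧
      G =O[cofinite] (fun n : ℤ => ((n : ℝ) ^ 3)⁻¹) ∧
      ∀ α : ℝ, α ≤ 2 → Summable (fun j : ℤ => |(j : ℝ)| ^ α * ‖G j‖) := by
  have hne : ∀ᶠ n : ℤ in cofinite, n ≠ 0 := (finite_singleton (0 : ℤ)).compl_mem_cofinite
  have habs : ∀ n : ℤ, n ≠ 0 → (1 : ℝ) ≤ |(n : ℝ)| := fun n hn => by
    exact_mod_cast Int.one_le_abs hn
  have hmul : ∀ n : ℤ, n ≠ 0 → |(n : ℝ)| ^ 2 * ‖G n‖ ≤ ‖F n‖ := fun n hn => by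
    have h0 : 0 < |(n : ℝ)| ^ 2 := pow_pos (one_pos.trans_le (habs n hn)) 2
    calc _ ≤ |(n : ℝ)| ^ 2 * ((|(n : ℝ)| ^ 2)⁻¹ * ‖F n‖) := by gcongr; exact hGF n hn
      _ = _ := by field_simp
  refine ⟨?_, ?_, fun α hα => ?_⟩
  · refine Summable.of_norm_bounded_eventually hF ?_
    filter_upwards [hne] with n hn
    rw [Real.norm_of_nonneg (by positivity), ← sq_abs]
    exact hmul n hn
  · refine Asymptotics.IsBigO.of_bound C ?_
    filter_upwards [hne] with n hn
    calc ‖G n‖ ≤ (|(n : ℝ)| ^ 2)⁻¹ * (C * |(n : ℝ)|⁻¹) := by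
          refine (hGF n hn).trans ?_
          gcongr
          exact hC n hn
      _ = _ := by
        rw [norm_inv, norm_pow, Real.norm_eq_abs, pow_succ |(n : ℝ)| 2, mul_inv]
        ring
  · refine Summable.of_norm_bounded_eventually hF ?_
    filter_upwards [hne] with n hn
    rw [Real.norm_of_nonneg (by positivity)]
    refine le_trans ?_ (hmul n hn)
    rw [← Real.rpow_two]
    gcongr
    exact habs n hn

theorem deriv₁_spectralRatio_half {H V : ℝ} (hH : H ∈ Ico (1 / 2 : ℝ) 1) (hV : 0 < V) {h : ℝ → ℝ}
    (h_cont : ContinuousOn h freq) (hd : DifferentiableOn ℝ h freq)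
    (h_half : deriv₁ h (1 / 2) = 0) : deriv₁ (spectralRatio H V h) (1 / 2) = 0 := by
  have hmem : (1 / 2 : ℝ) ∈ freq := ⟨by norm_num, by norm_num⟩
  have heq : EqOn (spectralRatio H V h)
      (fun x => h x * (smoothFactor H V x / aliasFactor H x)) freq := fun x hx => by
    exact (spectralRatio_eqOn hH hV h_cont hx).trans (mul_div_assoc _ _ _)
  have h1 := (hd _ hmem).hasDerivWithinAt.mul
    (hasDerivAt_smoothFactor_div_aliasFactor_half V hH.1).hasDerivWithinAt
  rw [deriv₁] at h_half ⊢
  rw [h_half, zero_mul, mul_zero, add_zero] at h1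
  exact (h1.congr heq (heq hmem)).derivWithin (uniqueDiffOn_freq _ hmem)

end FracDiff

end

/-! ### Assembly of the theorem. -/

theorem mainTheorem1 (H V : ℝ) (hH : H ∈ Ico (1 / 2 : ℝ) 1) (hV : 0 < V)
    (h : ℝ → ℝ)
    (h_even : ∀ x ∈ FracDiff.freq, h (-x) = h x)
    (h_pos : ∀ x ∈ FracDiff.freq, 0 < h x)
    (h_cont : ContinuousOn h FracDiff.freq)
    (h_C3 : ContDiffOn ℝ 3 h (Ioo (-1 / 2) (1 / 2)))
    (g : ℝ → ℝ) (hg : g = FracDiff.spectralRatio H V h)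
    (G : ℤ → ℂ) (hG : G = FracDiff.fourierCoefficient g) :
    -- the limit at the origin exists and has the stated value
    (Tendsto (fun x => FracDiff.fracSpectralDensity H h x / FracDiff.fgnSpectralDensity H V x)
        (𝓝[≠] 0) (𝓝 (g 0)) ∧
      g 0 = FracDiff.fracPrefactor H h / FracDiff.fgnPrefactor H V ∧
      g 0 = h 0 / (2 * Real.pi * V * FracDiff.hurstConst H)) ∧
    -- (i)
    ((∀ x ∈ FracDiff.freq, g (-x) = g x) ∧
      ContinuousOn g FracDiff.freq ∧
      (∀ x ∈ FracDiff.freq, 0 < g x) ∧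
      (∃ M : ℝ, ∀ x ∈ FracDiff.freq, |g x| ≤ M) ∧
      (∀ p : ℝ≥0∞, 0 < p → MemLp g p (volume.restrict FracDiff.freq))) ∧
    -- (ii)
    (DifferentiableOn ℝ g (Ioo (-1 / 2) (1 / 2)) ∧
      DifferentiableOn ℝ (FracDiff.deriv₁ g) (Ioo (-1 / 2) (1 / 2)) ∧
      (ContDiffOn ℝ 3 h FracDiff.freq →
        DifferentiableOn ℝ g FracDiff.freq ∧
        DifferentiableOn ℝ (FracDiff.deriv₁ g) FracDiff.freq) ∧
      ContDiffOn ℝ ∞ (fun x => g x / h x) (FracDiff.freq \ {0}) ∧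
      (∀ n : ℕ∞, ∀ x ∈ FracDiff.freq, x ≠ 0 →
        ContDiffWithinAt ℝ n h FracDiff.freq x → ContDiffWithinAt ℝ n g FracDiff.freq x)) ∧
    -- (iii)
    ((ContDiffOn ℝ 3 h FracDiff.freq →
        FracDiff.MemLambda (2 * H - 1).toNNReal (FracDiff.deriv₂ g) ∧
        BoundedVariationOn (FracDiff.deriv₂ g) FracDiff.freq) ∧
      (1 / 2 < H → ∀ β' : ℝ≥0, 2 * H - 1 < (β' : ℝ) →
        ¬ FracDiff.MemLambda β' (FracDiff.deriv₂ g) ∧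
        ¬ ∃ C : ℝ≥0, HolderOnWith C β' (FracDiff.deriv₂ g) (Ioo (-1 / 2) (1 / 2)))) ∧
    -- (iv)
    (ContDiffOn ℝ 3 h FracDiff.freq → FracDiff.deriv₁ h (1 / 2) = 0 →
      (∀ x ∈ FracDiff.freq,
        HasSum (fun j : ℤ => G j * Complex.exp (2 * Real.pi * Complex.I * j * x)) (g x : ℂ)) ∧
      Summable (fun j : ℤ => (j : ℝ) ^ 2 * ‖G j‖) ∧
      G =O[cofinite] (fun n : ℤ => ((n : ℝ) ^ 3)⁻¹) ∧
      Summable (fun j : ℤ => ‖G j‖) ∧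
      (∀ α : ℝ, 1 < α → α < 2 → Summable (fun j : ℤ => |(j : ℝ)| ^ α * ‖G j‖))) := by
  have heq : EqOn g (fun x => h x * FracDiff.smoothFactor H V x / FracDiff.aliasFactor H x)
      FracDiff.freq := hg ▸ FracDiff.spectralRatio_eqOn hH hV h_cont
  have hzero : (0 : ℝ) ∈ FracDiff.freq := mem_of_mem_nhds FracDiff.freq_mem_nhds_zero
  have hIoo : Ioo (-1 / 2 : ℝ) (1 / 2) ⊆ FracDiff.freq := Ioo_subset_Icc_self
  have hsf : ∀ x ∈ FracDiff.freq, 0 < FracDiff.smoothFactor H V x := fun x hx =>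
    FracDiff.smoothFactor_pos hH hV (FracDiff.freq_subset hx)
  have haf : ∀ x ∈ FracDiff.freq, 0 < FracDiff.aliasFactor H x := fun x hx =>
    FracDiff.aliasFactor_pos hH.1 (FracDiff.freq_subset hx)
  have g0 : g 0 = FracDiff.fracPrefactor H h / FracDiff.fgnPrefactor H V :=
    hg ▸ FracDiff.spectralRatio_zero hH hV h_cont
  have g_even : ∀ x ∈ FracDiff.freq, g (-x) = g x := fun x hx => by
    rw [heq hx, heq (FracDiff.neg_mem_freq hx)]
    simp only [h_even x hx, FracDiff.smoothFactor_neg, FracDiff.aliasFactor_neg]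
  have g_cont : ContinuousOn g FracDiff.freq :=
    (FracDiff.continuousOn_factorization V hH.1 h_cont).congr heq
  obtain ⟨M, hM⟩ := isCompact_Icc.exists_bound_of_continuousOn g_cont
  have expand := fun (T : Set ℝ) => FracDiff.exists_deriv₂_expansion hH hV h_cont
    (h_pos 0 hzero) (T := T)
  rw [← hg] at expand
  -- The expansion on the open interval needs no regularity of h at the end points; it serves the
  -- interior part of (ii) and the optimality in (iii).
  obtain ⟨i1, i2, bi, ri, hbi, hri, hei⟩ := expand (Ioo (-1 / 2) (1 / 2)) hIoo
    isOpen_Ioo.uniqueDiffOn (Ioo_mem_nhds (by norm_num) (by norm_num))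
    (fun x hx => mem_nhdsWithin_of_mem_nhds (Ioo_mem_nhds hx.1 hx.2)) h_C3
  have expandF := expand FracDiff.freq Subset.rfl FracDiff.uniqueDiffOn_freq
    FracDiff.freq_mem_nhds_zero (fun _ _ => self_mem_nhdsWithin)
  have hratio := FracDiff.contDiffOn_smoothFactor_div_aliasFactor V hH.1
  have hfreq0 : FracDiff.freq \ {0} ⊆ Ioo (-1 : ℝ) 1 \ {0} :=
    sdiff_subset_sdiff_left FracDiff.freq_subset
  have ha : 0 ≤ 2 * H - 1 := by linarith [hH.1]
  have ha1 : 2 * H - 1 < 1 := by linarith [hH.2]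
  refine ⟨⟨?_, g0, ?_⟩, ⟨g_even, g_cont, ?_, ⟨M, hM⟩, ?_⟩, ⟨?_, ?_, ?_, ?_, ?_⟩, ⟨?_, ?_⟩, ?_⟩
  · rw [heq hzero]
    exact FracDiff.tendsto_rawRatio hH hV h_cont
  · rw [g0, FracDiff.fracPrefactor_div_fgnPrefactor hH]
  · intro x hx
    rw [heq hx]
    exact div_pos (mul_pos (h_pos x hx) (hsf x hx)) (haf x hx)
  · intro p _
    refine MemLp.of_bound (g_cont.aestronglyMeasurable measurableSet_Icc) M ?_
    filter_upwards [ae_restrict_mem measurableSet_Icc] with x hx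
    exact hM x hx
  · exact fun x hx => ((i1 x hx).mono hIoo).differentiableWithinAt
  · exact fun x hx => ((i2 x hx).mono hIoo).differentiableWithinAt
  · intro hC3
    obtain ⟨d1, d2, -⟩ := expandF hC3
    exact ⟨fun x hx => (d1 x hx).differentiableWithinAt,
      fun x hx => (d2 x hx).differentiableWithinAt⟩
  · refine (hratio.mono hfreq0).congr fun x hx => ?_
    have := (h_pos x hx.1).ne'
    rw [heq hx.1]
    field_simp
  · intro n x hx hx0 hn
    have hm : ContDiffWithinAt ℝ n
        (fun x => FracDiff.smoothFactor H V x / FracDiff.aliasFactor H x) FracDiff.freq x :=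
      (((hratio.mono hfreq0) x ⟨hx, hx0⟩).of_le (WithTop.coe_le_coe.2 le_top)).mono_of_mem_nhdsWithin
        -- Away from 0, deleting the origin does not change the germ.
        (inter_mem self_mem_nhdsWithin (mem_nhdsWithin_of_mem_nhds
          (isOpen_compl_singleton.mem_nhds hx0)))
    refine (hn.mul hm).congr (fun y hy => ?_) ?_
    · exact (heq hy).trans (mul_div_assoc _ _ _)
    · exact (heq hx).trans (mul_div_assoc _ _ _)
  · intro hC3
    obtain ⟨-, -, b, r, -, hr, he⟩ := expandF hC3
    obtain ⟨L, hL⟩ := hr.exists_lipschitzOnWith one_ne_zero (convex_Icc _ _) isCompact_Icc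
    refine ⟨FracDiff.holderOnWith_const_mul_abs_rpow_add ha ha1.le (fun x hx y hy => ?_) hL he,
      FracDiff.boundedVariationOn_const_mul_abs_rpow_add ha hL he⟩
    exact abs_le.2 ⟨by linarith [hx.1, hy.2], by linarith [hx.2, hy.1]⟩
  · intro hH2 β' hβ
    have hnhds : Ioo (-1 / 2 : ℝ) (1 / 2) ∈ 𝓝 0 := Ioo_mem_nhds (by norm_num) (by norm_num)
    have key : ¬ ∃ C : ℝ≥0, HolderOnWith C β' (FracDiff.deriv₂ g) (Ioo (-1 / 2) (1 / 2)) :=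
      fun ⟨C, hC⟩ => FracDiff.not_holderOnWith_const_mul_abs_rpow_add (by linarith) ha1 hnhds hbi
        ((hri.contDiffAt hnhds).differentiableAt one_ne_zero) hei hβ hC
    exact ⟨fun ⟨C, hC⟩ => key ⟨C, hC.mono hIoo⟩, key⟩
  · intro hC3 h_half
    obtain ⟨d1, d2, b, r, -, hr, he⟩ := expandF hC3
    have hmem : (1 / 2 : ℝ) ∈ FracDiff.freq := ⟨by norm_num, by norm_num⟩
    have hneg : (-1 / 2 : ℝ) = -(1 / 2) := by norm_num
    have odd1 : ∀ x ∈ FracDiff.freq, FracDiff.deriv₁ g (-x) = -1 * FracDiff.deriv₁ g x :=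
      fun x hx => FracDiff.derivWithin_freq_neg (fun y hy => by rw [one_mul, g_even y hy]) hx
    have even2 : ∀ x ∈ FracDiff.freq, FracDiff.deriv₂ g (-x) = FracDiff.deriv₂ g x :=
      fun x hx => by
        have := FracDiff.derivWithin_freq_neg odd1 hx
        rwa [neg_neg, one_mul] at this
    have g_per : g (1 / 2) = g (-1 / 2) := by rw [hneg, g_even _ hmem]
    have g1_half : FracDiff.deriv₁ g (1 / 2) = 0 :=
      hg ▸ FracDiff.deriv₁_spectralRatio_half hH hV h_cont
        (hC3.differentiableOn (by norm_num)) h_half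
    -- As g' is odd, its end values agree only because they vanish.
    have g1_per : FracDiff.deriv₁ g (1 / 2) = FracDiff.deriv₁ g (-1 / 2) := by
      rw [hneg, odd1 _ hmem, g1_half, mul_zero]
    -- Both g'' and |x|^a are even, hence so is r on `freq`.
    have r_per : r (1 / 2) = r (-1 / 2) := by
      have e := even2 _ hmem
      rw [he _ hmem, he _ (FracDiff.neg_mem_freq hmem), abs_neg] at e
      rw [hneg]
      linarith
    have hpc := (FracDiff.continuous_abs_rpow ha).continuousOn (s := FracDiff.freq)
    have g2_cont : ContinuousOn (FracDiff.deriv₂ g) FracDiff.freq :=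
      ((continuousOn_const.mul hpc).add hr.continuousOn).congr he
    obtain ⟨s1, C1, hC1⟩ := FracDiff.fourierCoefficient_abs_rpow ha ha1
    obtain ⟨s2, C2, hC2⟩ := FracDiff.fourierCoefficient_of_contDiffOn hr r_per
    have hle : ∀ n, ‖FracDiff.fourierCoefficient (FracDiff.deriv₂ g) n‖ ≤
        |b| * ‖FracDiff.fourierCoefficient (fun x => |x| ^ (2 * H - 1)) n‖ +
          ‖FracDiff.fourierCoefficient r n‖ := fun n => by
      rw [FracDiff.fourierCoefficient_const_mul_add hpc hr.continuousOn b he n]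
      refine (norm_add_le _ _).trans_eq ?_
      rw [norm_mul, Complex.norm_real, Real.norm_eq_abs]
    obtain ⟨t1, t2, t3⟩ := FracDiff.summable_isBigO_of_norm_le (G := G) (C := |b| * C1 + C2)
      (fun n hn => hG ▸ FracDiff.norm_fourierCoefficient_le_of_deriv d1 d2 g2_cont g_per g1_per hn)
      (Summable.of_nonneg_of_le (fun _ => norm_nonneg _) hle ((s1.mul_left _).add s2))
      (fun n hn => (hle n).trans (by
        have := mul_le_mul_of_nonneg_left (hC1 n hn) (abs_nonneg b)
        have := hC2 n hn
        linarith))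
    have t0 : Summable fun j : ℤ => ‖G j‖ := by
      -- Exponent 0 gives plain summability, including j = 0, since `0 ^ 0 = 1`.
      simpa using t3 0 (by norm_num)
    refine ⟨fun x hx => ?_, t1, t2, t0, fun α _ hα => t3 α hα.le⟩
    rw [hG] at t0 ⊢
    exact FracDiff.hasSum_fourierCoefficient g_cont g_per t0 hx
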